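/- Let $n,m\ge 1$ be integers and $\alpha>0$. A smooth function $f\colon\mathbb{C}^n\to\mathbb{C}$ is called $m$-analytic if $\overline{D}^k f=0$ for every multi-index $k\in\mathbb{N}_0^n$ with $|k|=k_1+\dots+k_n=m$, where $\overline{D}^k=\partial_{\overline z_1}^{k_1}\cdots\partial_{\overline z_n}^{k_n}$. Let $\mathcal{F}_{\alpha,m}$ be the space of all $m$-analytic functions on $\mathbb{C}^n$ with $\int_{\mathbb{C}^n}|f(z)|^2 e^{-\alpha|z|^2}\,dz<\infty$. Let $\mathcal{H}_m$ be the space of all functions on $\mathbb{R}^n\times\mathbb{R}^n$ of the form $$(x,y)\mapsto 2^{n/2}\,e^{-\frac12|x|^2-\frac12|y|^2-i\langle x,y\rangle}\,f\!\left(\frac{x+iy}{\sqrt{\alpha}}\right),\qquad f\in\mathcal{F}_{\alpha,m},$$ with the inner product $\langle g,h\rangle=(2\pi)^{-n}\int_{\mathbb{R}^{2n}} g\,\overline{h}\,dx\,dy$. Then $\mathcal{H}_m$ has a unique reproducing kernel, that is, a unique family $(K_{x,y})_{x,y\in\mathbb{R}^n}$ in $\mathcal{H}_m$ with $g(x,y)=\langle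 g,K_{x,y}\rangle$ for all $g\in\mathcal{H}_m$ and $x,y\in\mathbb{R}^n$. For all $\xi,y,v\in\mathbb{R}^n$, the function $u\mapsto K_{0,y}(u,v)e^{-i\langle u,\xi\rangle}$ is Lebesgue integrable on $\mathbb{R}^n$, and $$L_{\xi,y}(v):=\frac{1}{(2\pi)^{n/2}}\int_{\mathbb{R}^n}K_{0,y}(u,v)\,e^{-i\langle u,\xi\rangle}\,du$$ satisfies $$L_{\xi,y}(v)=\sum_{k\in J_{n,m}}\overline{q_{k,\xi}(y)}\,q_{k,\xi}(v)=\sum_{k\in J_{n,m}}q_{k,\xi}(y)\,q_{k,\xi}(v),$$ where $J_{n,m}=\{k\in\mathbb{N}_0^n\colon |k|\le m-1\}$ is a set with $d=\binom{n+m-1}{n}$ elements, $$q_{k,\xi}(v)=2^{n/2}\pi^{n/4}\prod_{r=1}^n\psi_{k_r}\!\left(\frac{\xi_r+2v_r}{\sqrt2}\right),$$ and $\psi_j(t)=(2^j\,j!\,\sqrt{\pi})^{-1/2}e^{-t^2/2}H_j(t)$ are the Hermite functions, with $H_j$ the physicists' Hermite polynomials. -/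

import Mathlib

open MeasureTheory Complex
open scoped ComplexConjugate ContDiff

noncomputable section

namespace PolyFock

/-- The Wirtinger derivative `∂f/∂z̄_r = (∂f/∂x_r + i ∂f/∂y_r) / 2` on `ℂⁿ`. -/
def dbar {n : ℕ} (r : Fin n) (f : (Fin n → ℂ) → ℂ) : (Fin n → ℂ) → ℂ := fun z =>
  (1 / 2 : ℂ) * (fderiv ℝ f z (Pi.single r 1) + I * fderiv ℝ f z (Pi.single r I))

/-- The iterated Wirtinger derivative `D̄ᵏ` for a multi-index `k`: each `∂/∂z̄_r` is applied
`k r` times. -/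
def dbarPow {n : ℕ} (k : Fin n → ℕ) (f : (Fin n → ℂ) → ℂ) : (Fin n → ℂ) → ℂ :=
  (List.finRange n).foldr (fun r g => (dbar r)^[k r] g) f

/-- Homogeneously `m`-analytic functions: smooth functions on `ℂⁿ` with `D̄ᵏ f = 0` for all
multi-indices `k` with `|k| = m`. -/
def IsPolyanalytic {n : ℕ} (m : ℕ) (f : (Fin n → ℂ) → ℂ) : Prop :=
  ContDiff ℝ ∞ f ∧ ∀ k : Fin n → ℕ, ∑ r, k r = m → ∀ z, dbarPow k f z = 0

/-- The `m`-analytic Bargmann-Segal-Fock space over `ℂⁿ`: `m`-analytic functions that are square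
integrable with respect to the Gaussian weight `exp (-α |z|²)`, where `|z|` is the Euclidean
norm. -/
def fockSpace (n m : ℕ) (α : ℝ) : Set ((Fin n → ℂ) → ℂ) :=
  {f | IsPolyanalytic m f ∧
    Integrable (fun z : Fin n → ℂ => ‖f z‖ ^ 2 * Real.exp (-α * ∑ r, ‖z r‖ ^ 2)) volume}

/-- The flattening operator
`f ↦ 2^{n/2} exp (-|x|²/2 - |y|²/2 - i⟨x,y⟩) f ((x + i y) / √α)`. -/
def flatten (n : ℕ) (α : ℝ) (f : (Fin n → ℂ) → ℂ) : (Fin n → ℝ) × (Fin n → ℝ) → ℂ := fun p =>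
  (((2 : ℝ) ^ ((n : ℝ) / 2) : ℝ) : ℂ) *
    cexp (-(1 / 2 : ℂ) * ∑ r, (p.1 r : ℂ) ^ 2 - (1 / 2 : ℂ) * ∑ r, (p.2 r : ℂ) ^ 2
      - I * ∑ r, (p.1 r : ℂ) * (p.2 r : ℂ)) *
    f (fun r => ((p.1 r : ℂ) + I * (p.2 r : ℂ)) / ((√α : ℝ) : ℂ))

/-- The flattened space: the image of the Fock space under the flattening operator. -/
def flatSpace (n m : ℕ) (α : ℝ) : Set ((Fin n → ℝ) × (Fin n → ℝ) → ℂ) :=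
  flatten n α '' fockSpace n m α

/-- The inner product of `L²(ℝ²ⁿ)` with respect to Lebesgue measure multiplied by `(2π)⁻ⁿ`. -/
def flatInner {n : ℕ} (f g : (Fin n → ℝ) × (Fin n → ℝ) → ℂ) : ℂ :=
  ((((2 * Real.pi) ^ n)⁻¹ : ℝ) : ℂ) * ∫ p, f p * conj (g p)

/-- `K` is a reproducing kernel of the space of functions `H` with inner product `ip` (linear in
its first argument): all `K x` lie in `H`, and `f x = ⟨f, K x⟩` for all `f` in `H`. -/
def IsReproducingKernel {X : Type*} (H : Set (X → ℂ)) (ip : (X → ℂ) → (X → ℂ) → ℂ)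
    (K : X → X → ℂ) : Prop :=
  ∀ x, K x ∈ H ∧ ∀ f ∈ H, f x = ip f (K x)

/-- The integrand `u ↦ K_{0,y}(u,v) exp (-i⟨u,ξ⟩)` of the horizontal Fourier transform. -/
def horizontalIntegrand {n : ℕ}
    (K : (Fin n → ℝ) × (Fin n → ℝ) → (Fin n → ℝ) × (Fin n → ℝ) → ℂ)
    (ξ y v u : Fin n → ℝ) : ℂ :=
  K (0, y) (u, v) * cexp (-I * ∑ r, (u r : ℂ) * (ξ r : ℂ))

/-- The horizontal Fourier transform
`L_{ξ,y}(v) = (2π)^{-n/2} ∫ K_{0,y}(u,v) exp (-i⟨u,ξ⟩) du`. -/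
def horizontalFourier {n : ℕ}
    (K : (Fin n → ℝ) × (Fin n → ℝ) → (Fin n → ℝ) × (Fin n → ℝ) → ℂ)
    (ξ y v : Fin n → ℝ) : ℂ :=
  (((2 * Real.pi) ^ (-(n : ℝ) / 2) : ℝ) : ℂ) * ∫ u, horizontalIntegrand K ξ y v u

/-- The physicists' Hermite polynomials `H₀ = 1`, `H_{j+1} = 2 X H_j - H_j'`. -/
def physHermite : ℕ → Polynomial ℝ
  | 0 => 1
  | j + 1 => 2 * Polynomial.X * physHermite j - Polynomial.derivative (physHermite j)

/-- The Hermite functions `ψ_j(t) = (2^j j! √π)^{-1/2} exp (-t²/2) H_j(t)`. -/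
def hermiteFun (j : ℕ) (t : ℝ) : ℝ :=
  ((2 : ℝ) ^ j * (j.factorial : ℝ) * √Real.pi) ^ (-(1 / 2 : ℝ)) *
    Real.exp (-(1 / 2) * t ^ 2) * (physHermite j).eval t

/-- `q_{k,ξ}(v) = 2^{n/2} π^{n/4} ∏_r ψ_{k_r}((ξ_r + 2 v_r)/√2)`, as a complex number. -/
def q {n : ℕ} (k : Fin n → ℕ) (ξ v : Fin n → ℝ) : ℂ :=
  (((2 : ℝ) ^ ((n : ℝ) / 2) * Real.pi ^ ((n : ℝ) / 4) *
    ∏ r, hermiteFun (k r) ((ξ r + 2 * v r) / √2) : ℝ) : ℂ)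

/-- The set of multi-indices `k ∈ ℕ₀ⁿ` with `|k| ≤ m - 1`, for `m ≥ 1`. -/
def multiIndices (n m : ℕ) : Finset (Fin n → ℕ) :=
  (Fintype.piFinset fun _ : Fin n => Finset.range m).filter fun k => ∑ r, k r ≤ m - 1

theorem mem_multiIndices {n m : ℕ} (hm : 1 ≤ m) (k : Fin n → ℕ) :
    k ∈ multiIndices n m ↔ ∑ r, k r ≤ m - 1 := by
  simp only [multiIndices, Finset.mem_filter, Fintype.mem_piFinset, Finset.mem_range,
    and_iff_right_iff_imp]
  intro h r
  have := Finset.single_le_sum (f := k) (fun i _ => Nat.zero_le (k i)) (Finset.mem_univ r)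
  omega

end PolyFock

end

/-! On a complex line an `m`-analytic function is a sum `∑_{k < m} x̄ᵏ h_k(x)` with entire
coefficients `h_k`, so its mean over the circle of radius `ρ` is a polynomial in `ρ²` of degree less
than `m` whose constant term is the value at the centre. Under the Gaussian weight, the Laguerre
polynomial `L_{m-1}^{(n)}(α |w|²)` annihilates the other powers of `ρ²`, hence reproduces the value
at the origin, and the unitary Weyl translations carry this to every point. The resulting kernel is
turned into Hermite functions by the addition formula `∑_{|k| ≤ m-1} ∏ᵣ L_{k_r}(t_r) =
L_{m-1}^{(n)}(∑ᵣ t_r)`, which splits the horizontal Fourier transform into one-dimensional Gaussian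
integrals. There `L_j(u² + d²)` is, up to a factor, a complex Hermite polynomial of Itô, whose
Fourier-Gauss integral is a product of two Hermite polynomials. -/

noncomputable section

namespace PolyFock

section Laguerre

open Polynomial

/-- The generalized Laguerre polynomial `L_M^{(a)}`, for a natural number `a`. -/
def laguerre (a M : ℕ) : ℝ[X] :=
  ∑ i ∈ Finset.range (M + 1),
    C ((-1) ^ i * ((M + a).choose (a + i) : ℝ) / (i.factorial : ℝ)) * X ^ i

theorem coeff_laguerre (a M i : ℕ) :
    (laguerre a M).coeff i = (-1) ^ i * ((M + a).choose (a + i) : ℝ) / (i.factorial : ℝ) := by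
  simp only [laguerre, finsetSum_coeff, coeff_C_mul_X_pow, Finset.sum_ite_eq, Finset.mem_range]
  refine ite_eq_left_iff.2 fun hi => ?_
  rw [Nat.choose_eq_zero_of_lt (by omega), Nat.cast_zero, mul_zero, zero_div]

theorem eval_laguerre (a M : ℕ) (t : ℝ) : (laguerre a M).eval t = ∑ i ∈ Finset.range (M + 1),
    (-1) ^ i * ((M + a).choose (a + i) : ℝ) / (i.factorial : ℝ) * t ^ i := by
  simp only [laguerre, eval_finsetSum, eval_mul, eval_C, eval_pow, eval_X]

theorem eval_zero_laguerre (a M : ℕ) : (laguerre a M).eval 0 = (M + a).choose a := by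
  simp [← coeff_zero_eq_eval_zero, coeff_laguerre]

theorem laguerre_zero (a : ℕ) : laguerre a 0 = 1 := by
  simp [laguerre]

theorem succ_mul_choose_eq_sub_mul_choose_succ (n k : ℕ) :
    ((n : ℝ) + 1) * n.choose k = ((n : ℝ) + 1 - k) * (n + 1).choose k := by
  rcases le_or_gt k (n + 1) with hk | hk
  · have h := Nat.choose_mul_succ_eq n k
    have hcast : ((n + 1 - k : ℕ) : ℝ) = (n : ℝ) + 1 - k := by push_cast [Nat.cast_sub hk]; ring
    rw [← hcast]
    exact_mod_cast (mul_comm _ _).trans (h.trans (mul_comm _ _))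
  · simp [Nat.choose_eq_zero_of_lt hk, Nat.choose_eq_zero_of_lt (Nat.lt_of_succ_lt hk)]

theorem succ_mul_laguerre_succ (a M : ℕ) : C ((M : ℝ) + 1) * laguerre a (M + 1) =
    C ((M : ℝ) + 1 + a) * laguerre a M - X * laguerre (a + 1) M := by
  ext i
  have hchoose := succ_mul_choose_eq_sub_mul_choose_succ (M + a) (a + i)
  push_cast at hchoose
  rcases i with _ | i
  · simp only [coeff_sub, coeff_C_mul, coeff_X_mul_zero, coeff_laguerre, add_right_comm M 1 a,
      Nat.cast_zero] at hchoose ⊢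
    linear_combination -hchoose
  · simp only [coeff_sub, coeff_C_mul, coeff_X_mul, coeff_laguerre, add_right_comm M 1 a,
      ← add_assoc M a 1, add_right_comm a 1 i, ← add_assoc a i 1, Nat.factorial_succ]
      at hchoose ⊢
    push_cast at hchoose ⊢
    field_simp
    linear_combination (-1) ^ i * hchoose

end Laguerre

section GeneratingFunction

open PowerSeries

variable {R : Type*} [CommRing R]

theorem coeff_one_sub_X_pow (N i : ℕ) :
    coeff i ((1 - X : R⟦X⟧) ^ N) = (-1) ^ i * (N.choose i : R) := by
  have h : (1 - X : R⟦X⟧) ^ N =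
      rescale (-1) (((1 + Polynomial.X : Polynomial R) ^ N : Polynomial R) : R⟦X⟧) := by
    simp [rescale_X, sub_eq_add_neg]
  rw [h, coeff_rescale, Polynomial.coeff_coe, Polynomial.coeff_one_add_X_pow]

/- Compare coefficients in `(1 - X)^{-(N + k + 1)} (1 - X)^{M + N + 1} = (1 - X)^{M - k}`. -/
theorem alternating_sum_choose_mul_choose (N M k : ℕ) (hk : k ≤ M) :
    ∑ i ∈ Finset.range (M + 1), (-1 : R) ^ i * ((M + (N + 1)).choose (N + 1 + i) : R) *
      ((N + k + i).choose (N + k) : R) = if k = 0 then 1 else 0 := by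
  have hseries : (PowerSeries.mk (1 : ℕ → R)) ^ (N + k + 1) * (1 - X) ^ (M + (N + 1)) =
      (1 - X) ^ (M - k) := by
    rw [show M + (N + 1) = (N + k + 1) + (M - k) by omega, pow_add _ _ (M - k), ← mul_assoc,
      ← mul_pow, mk_one_mul_one_sub_eq_one, one_pow, one_mul]
  have hcoeff := congrArg (coeff M) hseries
  rw [coeff_mul, Finset.Nat.sum_antidiagonal_eq_sum_range_succ_mk, mk_one_pow_eq_mk_choose_add]
    at hcoeff
  simp only [coeff_mk, coeff_one_sub_X_pow] at hcoeff
  have hterm : ∀ i ∈ Finset.range (M + 1),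
      (-1 : R) ^ i * ((M + (N + 1)).choose (N + 1 + i) : R) * ((N + k + i).choose (N + k) : R) =
      (-1) ^ M * (((N + k + i).choose (N + k) : R) *
        ((-1) ^ (M - i) * ((M + (N + 1)).choose (M - i) : R))) := by
    intro i hi
    obtain ⟨j, rfl⟩ := Nat.exists_eq_add_of_le (Nat.lt_succ_iff.1 (Finset.mem_range.1 hi))
    rw [Nat.add_sub_cancel_left, Nat.choose_symm_of_eq_add (show i + j + (N + 1) = _ + j by ring),
      pow_add]
    linear_combination -(-1 : R) ^ i * ((i + j + (N + 1)).choose j : R) *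
      ((N + k + i).choose (N + k) : R) * (Even.neg_one_pow ⟨j, rfl⟩ : (-1 : R) ^ (j + j) = 1)
  rw [Finset.sum_congr rfl hterm, ← Finset.mul_sum, hcoeff]
  split_ifs with h
  · simp [h, ← mul_pow]
  · simp [Nat.choose_eq_zero_of_lt (show M - k < M by omega)]

/-- The power series `exp (-t X / (1 - X))`; its product with `(1 - X)^{-(a + 1)}` is the generating
function of the Laguerre polynomials `L_M^{(a)}` at `t`. -/
def laguerreExp (t : ℝ) : ℝ⟦X⟧ :=
  subst (X * PowerSeries.mk (1 : ℕ → ℝ) : ℝ⟦X⟧) (rescale (-t) (exp ℝ))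

theorem hasSubst_X_mul (f : R⟦X⟧) : HasSubst (X * f) :=
  HasSubst.of_constantCoeff_zero' (by simp)

theorem laguerreExp_add (s t : ℝ) : laguerreExp (s + t) = laguerreExp s * laguerreExp t := by
  rw [laguerreExp, laguerreExp, laguerreExp, ← subst_mul (hasSubst_X_mul _),
    exp_mul_exp_eq_exp_add, neg_add]

theorem laguerreExp_zero : laguerreExp 0 = 1 := by
  rw [laguerreExp, neg_zero, rescale_zero_apply, ← coe_substAlgHom (hasSubst_X_mul _)]
  simp

theorem laguerreExp_sum {ι : Type*} (S : Finset ι) (t : ι → ℝ) :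
    laguerreExp (∑ r ∈ S, t r) = ∏ r ∈ S, laguerreExp (t r) := by
  classical
  induction S using Finset.induction_on with
  | empty => simp [laguerreExp_zero]
  | insert r S hr ih => rw [Finset.sum_insert hr, Finset.prod_insert hr, laguerreExp_add, ih]

theorem coeff_laguerreExp_of_le {i M : ℕ} (h : i ≤ M) (t : ℝ) :
    coeff i (laguerreExp t) = ∑ d ∈ Finset.range (M + 1), (-t) ^ d / (d.factorial : ℝ) *
      coeff i ((X * PowerSeries.mk (1 : ℕ → ℝ)) ^ d : ℝ⟦X⟧) := by
  rw [laguerreExp, coeff_subst' (hasSubst_X_mul _),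
    finsum_eq_sum_of_support_subset (s := Finset.range (M + 1))]
  · refine Finset.sum_congr rfl fun d _ => ?_
    simp [coeff_exp, div_eq_mul_inv]
  · refine Function.support_subset_iff'.2 fun d hd => ?_
    rw [mul_pow, coeff_X_pow_mul', if_neg, smul_zero]
    simp only [Finset.coe_range, Set.mem_Iio] at hd
    omega

theorem coeff_mk_one_pow_mul_laguerreExp (a M : ℕ) (t : ℝ) :
    coeff M (PowerSeries.mk 1 ^ (a + 1) * laguerreExp t) = (laguerre a M).eval t := by
  have htrunc : coeff M (PowerSeries.mk 1 ^ (a + 1) * laguerreExp t) =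
      coeff M (PowerSeries.mk 1 ^ (a + 1) * ∑ d ∈ Finset.range (M + 1),
        C ((-t) ^ d / (d.factorial : ℝ)) * (X * PowerSeries.mk (1 : ℕ → ℝ)) ^ d : ℝ⟦X⟧) := by
    rw [coeff_mul, coeff_mul]
    refine Finset.sum_congr rfl fun p hp => ?_
    rw [coeff_laguerreExp_of_le (Finset.HasAntidiagonal.antidiagonal.snd_le hp)]
    simp only [map_sum, coeff_C_mul]
  rw [htrunc, Finset.mul_sum, map_sum, eval_laguerre]
  refine Finset.sum_congr rfl fun d hd => ?_
  have hd : d ≤ M := Nat.lt_succ_iff.1 (Finset.mem_range.1 hd)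
  have hshift : PowerSeries.mk 1 ^ (a + 1) *
      (C ((-t) ^ d / (d.factorial : ℝ)) * (X * PowerSeries.mk (1 : ℕ → ℝ)) ^ d) =
      C ((-t) ^ d / (d.factorial : ℝ)) * (X ^ d * PowerSeries.mk 1 ^ (a + d + 1)) := by
    ring
  rw [hshift, coeff_C_mul, coeff_X_pow_mul', if_pos hd, mk_one_pow_eq_mk_choose_add, coeff_mk,
    show a + d + (M - d) = M + a by omega, neg_pow]
  ring

theorem coeff_mk_one_mul (M : ℕ) (f : R⟦X⟧) :
    coeff M (PowerSeries.mk 1 * f) = ∑ j ∈ Finset.range (M + 1), coeff j f := by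
  rw [mul_comm, coeff_mul, Finset.Nat.sum_antidiagonal_eq_sum_range_succ_mk]
  simp

theorem sum_multiIndices_eq_sum_finsuppAntidiag (n M : ℕ) {A : Type*} [AddCommMonoid A]
    (f : (Fin n → ℕ) → A) : ∑ k ∈ multiIndices n (M + 1), f k =
      ∑ j ∈ Finset.range (M + 1), ∑ l ∈ Finset.univ.finsuppAntidiag j, f l := by
  have hmaps : ∀ k ∈ multiIndices n (M + 1), ∑ r, k r ∈ Finset.range (M + 1) := fun k hk =>
    Finset.mem_range_succ_iff.2 ((mem_multiIndices M.succ_pos k).1 hk)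
  rw [← Finset.sum_fiberwise_of_maps_to hmaps]
  refine Finset.sum_congr rfl fun j hj => ?_
  refine Finset.sum_bij' (fun k _ => Finsupp.equivFunOnFinite.symm k) (fun l _ => ⇑l) ?_ ?_
    (fun _ _ => rfl) (fun l _ => Finsupp.equivFunOnFinite.symm_apply_apply l) (fun _ _ => rfl)
  · intro k hk
    simpa [Finset.mem_finsuppAntidiag] using (Finset.mem_filter.1 hk).2
  · intro l hl
    have hsum : ∑ r, l r = j := (Finset.mem_finsuppAntidiag.1 hl).1
    refine Finset.mem_filter.2 ⟨(mem_multiIndices M.succ_pos _).2 ?_, hsum⟩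
    exact hsum.trans_le (Finset.mem_range_succ_iff.1 hj)

theorem sum_multiIndices_prod_laguerre (n M : ℕ) (t : Fin n → ℝ) :
    ∑ k ∈ multiIndices n (M + 1), ∏ r, (laguerre 0 (k r)).eval (t r) =
      (laguerre n M).eval (∑ r, t r) := by
  have hprod : PowerSeries.mk (1 : ℕ → ℝ) ^ n * laguerreExp (∑ r, t r) =
      ∏ r, (PowerSeries.mk 1 ^ (0 + 1) * laguerreExp (t r)) := by
    rw [laguerreExp_sum, Finset.prod_mul_distrib]
    simp
  rw [← coeff_mk_one_pow_mul_laguerreExp, pow_succ', mul_assoc, coeff_mk_one_mul, hprod,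
    sum_multiIndices_eq_sum_finsuppAntidiag]
  simp_rw [coeff_prod, coeff_mk_one_pow_mul_laguerreExp]

theorem card_multiIndices (n M : ℕ) : (multiIndices n (M + 1)).card = (n + M).choose n := by
  have h := sum_multiIndices_prod_laguerre n M 0
  simp only [Pi.zero_apply, eval_zero_laguerre, Finset.sum_const_zero, add_zero,
    Nat.choose_zero_right, Nat.cast_one, Finset.prod_const_one, Finset.sum_const,
    nsmul_eq_mul, mul_one] at h
  rw [add_comm n M]
  exact_mod_cast h

end GeneratingFunction

section Hermite

open Polynomial

theorem derivative_hermite_succ (j : ℕ) :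
    derivative (hermite (j + 1)) = ((j : ℤ[X]) + 1) * hermite j := by
  induction j with
  | zero => simp
  | succ j ih =>
    rw [hermite_succ (j + 1), derivative_sub, derivative_mul, derivative_X, ih, derivative_mul,
      hermite_succ j]
    simp only [derivative_add, derivative_natCast, derivative_one]
    push_cast
    ring

theorem aeval_hermite_succ {R : Type*} [CommRing R] (x : R) (j : ℕ) :
    aeval x (hermite (j + 1)) = x * aeval x (hermite j) - j * aeval x (hermite (j - 1)) := by
  rw [hermite_succ, map_sub, map_mul, aeval_X]
  rcases j with _ | j
  · simp
  · simp only [derivative_hermite_succ, map_mul, map_add, map_natCast, map_one, Nat.cast_succ,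
      Nat.add_sub_cancel]

theorem physHermite_eq_hermite_comp (j : ℕ) : physHermite j =
    C (√2 ^ j) * ((hermite j).map (Int.castRingHom ℝ)).comp (C √2 * X) := by
  induction j with
  | zero => simp [physHermite]
  | succ j ih =>
    have htwo : (2 : ℝ[X]) = C √2 * C √2 := by
      rw [← C_mul, Real.mul_self_sqrt zero_le_two]; rfl
    rw [physHermite, ih, htwo, hermite_succ]
    simp only [derivative_C_mul, derivative_comp, derivative_X, Polynomial.map_sub,
      Polynomial.map_mul, map_X, derivative_map, sub_comp, mul_comp, X_comp, pow_succ, C_mul]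
    ring

theorem eval_physHermite_div_sqrt_two (j : ℕ) (x : ℝ) :
    (physHermite j).eval (x / √2) = √2 ^ j * aeval x (hermite j) := by
  rw [physHermite_eq_hermite_comp, eval_mul, eval_C, eval_comp, eval_mul, eval_C, eval_X,
    mul_div_cancel₀ x (Real.sqrt_ne_zero'.2 two_pos), eval_map, aeval_def]
  rfl

theorem hermiteFun_div_sqrt_two (j : ℕ) (x : ℝ) : hermiteFun j (x / √2) =
    (√(j.factorial * √Real.pi))⁻¹ * Real.exp (-(1 / 4) * x ^ 2) * aeval x (hermite j) := by
  have hpow : √((2 : ℝ) ^ j) = √2 ^ j := by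
    rw [Real.sqrt_eq_iff_eq_sq (by positivity) (by positivity), ← pow_mul, mul_comm, pow_mul,
      Real.sq_sqrt zero_le_two]
  have hexp : -(1 / 2) * (x / √2) ^ 2 = -(1 / 4) * x ^ 2 := by
    rw [div_pow, Real.sq_sqrt zero_le_two]; ring
  rw [hermiteFun, eval_physHermite_div_sqrt_two, hexp, Real.rpow_neg (by positivity),
    ← Real.sqrt_eq_rpow, mul_assoc ((2 : ℝ) ^ j), Real.sqrt_mul (by positivity), hpow]
  field_simp

theorem sqrt_pi_mul_hermiteFun_mul_hermiteFun (j : ℕ) (s t : ℝ) :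
    √Real.pi * hermiteFun j (s / √2) * hermiteFun j (t / √2) = (j.factorial : ℝ)⁻¹ *
      Real.exp (-(1 / 4) * (s ^ 2 + t ^ 2)) * aeval s (hermite j) * aeval t (hermite j) := by
  have hnorm : (√(j.factorial * √Real.pi))⁻¹ * (√(j.factorial * √Real.pi))⁻¹ * √Real.pi =
      (j.factorial : ℝ)⁻¹ := by
    rw [← mul_inv, Real.mul_self_sqrt (by positivity)]
    field_simp
  rw [hermiteFun_div_sqrt_two, hermiteFun_div_sqrt_two, mul_add, Real.exp_add]
  linear_combination Real.exp (-(1 / 4) * s ^ 2) * Real.exp (-(1 / 4) * t ^ 2) *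
    aeval s (hermite j) * aeval t (hermite j) * hnorm

end Hermite

section ItoHermite

open Polynomial

variable {R : Type*} [CommRing R]

/-- The complex Hermite polynomials of Itô, `H_{j,l}(x, y) = ∑ᵢ (-1)ⁱ i! (j choose i) (l choose i)
x^{j-i} y^{l-i}`, encoded by the recurrence `H_{j+1,l} = x H_{j,l} - l H_{j,l-1}`. -/
def itoHermite (x y : R) : ℕ → ℕ → R
  | 0, l => y ^ l
  | j + 1, l => x * itoHermite x y j l - l * itoHermite x y j (l - 1)

theorem derivative_itoHermite {x y : R[X]} (hx : derivative x = 1) (hy : derivative y = 1)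
    (j l : ℕ) : derivative (itoHermite x y j l) =
      j * itoHermite x y (j - 1) l + l * itoHermite x y j (l - 1) := by
  induction j generalizing l with
  | zero => simp [itoHermite, derivative_pow, hy]
  | succ j ih =>
    have hraise : (j : R[X]) * itoHermite x y j l = j * (x * itoHermite x y (j - 1) l -
        l * itoHermite x y (j - 1) (l - 1)) := by
      rcases j with _ | j
      · simp
      · rfl
    simp only [itoHermite, derivative_sub, derivative_mul, derivative_natCast, ih, hx]
    push_cast [Nat.add_sub_cancel]
    linear_combination -hraise

theorem itoHermite_eq_aeval_laguerre [Algebra ℝ R] (x y : R) (j a : ℕ) :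
    itoHermite x y j (j + a) = (-1) ^ j * j.factorial * y ^ a * aeval (x * y) (laguerre a j) := by
  induction j generalizing a with
  | zero => simp [itoHermite, laguerre_zero]
  | succ j ih =>
    have hrec := congrArg (aeval (x * y)) (succ_mul_laguerre_succ a j)
    simp only [map_mul, map_sub, aeval_X, map_add, map_natCast, map_one] at hrec
    rw [itoHermite, show j + 1 + a - 1 = j + a by omega, show j + 1 + a = j + (a + 1) by ring, ih,
      ih, Nat.factorial_succ]
    push_cast
    linear_combination (-1) ^ j * (j.factorial : R) * y ^ a * hrec

end ItoHermite

section GaussFourier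

open Polynomial

/-- The Gaussian wave `exp (-u²/2 - i u η)`. -/
def gaussWave (η u : ℝ) : ℂ := cexp (-(1 / 2 : ℂ) * (u : ℂ) ^ 2 - I * (u : ℂ) * (η : ℂ))

theorem continuous_gaussWave (η : ℝ) : Continuous (gaussWave η) := by
  unfold gaussWave
  fun_prop

theorem norm_gaussWave (η u : ℝ) : ‖gaussWave η u‖ = Real.exp (-(1 / 2) * u ^ 2) := by
  rw [gaussWave, Complex.norm_exp]
  congr 1
  simp [pow_two]

theorem integrable_gaussWave_mul_eval (η : ℝ) (p : ℂ[X]) :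
    Integrable (fun u : ℝ => gaussWave η u * p.eval (u : ℂ)) := by
  induction p using Polynomial.induction_on' with
  | add p q hp hq =>
    simp only [eval_add, mul_add]
    exact hp.add hq
  | monomial k c =>
    have hpow : Integrable (fun u : ℝ => u ^ k * Real.exp (-(1 / 2) * u ^ 2)) := by
      simpa using integrable_rpow_mul_exp_neg_mul_sq (b := 1 / 2) one_half_pos
        (s := k) (neg_one_lt_zero.trans_le k.cast_nonneg)
    refine (hpow.norm.const_mul ‖c‖).mono'
      (((continuous_gaussWave η).mul (by fun_prop)).aestronglyMeasurable) (.of_forall fun u => ?_)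
    simp only [norm_mul, norm_gaussWave, eval_monomial, norm_pow, norm_real, Real.norm_eq_abs,
      Real.abs_exp]
    exact le_of_eq (by ring)

/-- The functional `p ↦ ∫ p(u) exp (-u²/2 - i u η) du`, the Fourier transform of a polynomial
against the Gaussian, normalized without a factor `(2π)^{-1/2}`. -/
def gaussFourier (η : ℝ) : ℂ[X] →ₗ[ℂ] ℂ where
  toFun p := ∫ u : ℝ, gaussWave η u * p.eval (u : ℂ)
  map_add' p q := by
    simp only [eval_add, mul_add]
    exact integral_add (integrable_gaussWave_mul_eval η p) (integrable_gaussWave_mul_eval η q)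
  map_smul' c p := by
    simp only [eval_smul, smul_eq_mul, mul_left_comm _ c, integral_const_mul, RingHom.id_apply]

theorem gaussFourier_apply (η : ℝ) (p : ℂ[X]) :
    gaussFourier η p = ∫ u : ℝ, gaussWave η u * p.eval (u : ℂ) :=
  rfl

theorem hasDerivAt_gaussWave (η u : ℝ) :
    HasDerivAt (gaussWave η) (-((u : ℂ) + I * η) * gaussWave η u) u := by
  have hid : HasDerivAt (fun u : ℝ => (u : ℂ)) 1 u := Complex.ofRealCLM.hasDerivAt
  refine (((hid.pow 2).const_mul (-(1 / 2 : ℂ))).sub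
    ((hid.const_mul I).mul_const (η : ℂ))).cexp.congr_deriv ?_
  simp only [gaussWave, Pi.pow_apply, Pi.sub_apply]
  push_cast
  ring

theorem gaussFourier_X_add_C_mul (η : ℝ) (p : ℂ[X]) :
    gaussFourier η ((X + C (I * η)) * p) = gaussFourier η (derivative p) := by
  rw [← sub_eq_zero, ← map_sub, gaussFourier_apply]
  have hderiv (u : ℝ) : HasDerivAt (fun u : ℝ => -(gaussWave η u * p.eval (u : ℂ)))
      (gaussWave η u * ((X + C (I * η)) * p - derivative p).eval (u : ℂ)) u := by
    refine ((hasDerivAt_gaussWave η u).mul (p.hasDerivAt (u : ℂ)).comp_ofReal).neg.congr_deriv ?_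
    simp only [eval_sub, eval_mul, eval_add, eval_X, eval_C]
    ring
  exact integral_eq_zero_of_hasDerivAt_of_integrable hderiv (integrable_gaussWave_mul_eval _ _)
    (integrable_gaussWave_mul_eval _ _).neg

theorem gaussFourier_one (η : ℝ) :
    gaussFourier η 1 = ((√(2 * Real.pi) * Real.exp (-(1 / 2) * η ^ 2) : ℝ) : ℂ) := by
  have hwave (u : ℝ) :
      gaussWave η u = cexp (I * -(η : ℂ) * u) * cexp (-(1 / 2) * (u : ℂ) ^ 2) := by
    rw [gaussWave, ← Complex.exp_add]
    congr 1
    ring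
  simp only [gaussFourier_apply, eval_one, mul_one, hwave]
  rw [fourierIntegral_gaussian (by norm_num) (-(η : ℂ)), Real.sqrt_eq_rpow]
  push_cast
  rw [Complex.ofReal_cpow (by positivity)]
  push_cast
  congr 2 <;> ring

theorem eq_aeval_hermite_of_recurrence {s : ℕ → ℂ} {x : ℂ}
    (hs : ∀ j, s (j + 1) = -I * x * s j + j * s (j - 1)) (j : ℕ) :
    s j = (-I) ^ j * aeval x (hermite j) * s 0 := by
  induction j using Nat.twoStepInduction with
  | zero => simp
  | one => simp [hs 0]
  | more j ih ih' =>
    rw [hs, ih', aeval_hermite_succ _ (j + 1), Nat.add_sub_cancel, ih]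
    linear_combination (-I) ^ j * (j + 1 : ℕ) * aeval x (hermite j) * s 0 * I_sq

variable (η d : ℝ)

theorem gaussFourier_X_sub_C_pow (l : ℕ) : gaussFourier η ((X - C (I * d)) ^ l) =
    (-I) ^ l * aeval ((η : ℂ) + d) (hermite l) * gaussFourier η 1 := by
  have h := eq_aeval_hermite_of_recurrence (x := (η : ℂ) + d)
    (s := fun l => gaussFourier η ((X - C (I * d)) ^ l)) fun l => ?_
  · simpa only [pow_zero] using h l
  · have hsplit : (X - C (I * (d : ℂ))) ^ (l + 1) = (X + C (I * (η : ℂ))) * (X - C (I * d)) ^ l +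
        (-I * (η + d)) • (X - C (I * d)) ^ l := by
      rw [smul_eq_C_mul, pow_succ]
      simp only [C_mul, C_add, C_neg]
      ring
    have hderiv : derivative ((X - C (I * (d : ℂ))) ^ l) =
        (l : ℂ) • (X - C (I * d)) ^ (l - 1) := by
      simp [derivative_pow, smul_eq_C_mul]
    rw [hsplit, map_add, gaussFourier_X_add_C_mul, hderiv, map_smul, map_smul, smul_eq_mul,
      smul_eq_mul]
    ring

theorem gaussFourier_itoHermite (j l : ℕ) :
    gaussFourier η (itoHermite (X + C (I * d)) (X - C (I * d)) j l) = (-I) ^ (j + l) *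
      aeval ((η : ℂ) - d) (hermite j) * aeval ((η : ℂ) + d) (hermite l) * gaussFourier η 1 := by
  set H := itoHermite (X + C (I * (d : ℂ))) (X - C (I * d)) with hH
  have h := eq_aeval_hermite_of_recurrence (x := (η : ℂ) - d)
    (s := fun j => gaussFourier η (H j l)) fun j => ?_
  · rw [h j, hH, itoHermite, gaussFourier_X_sub_C_pow]
    ring
  · have hsplit : H (j + 1) l = (X + C (I * (η : ℂ))) * H j l +
        (-I * (η - d)) • H j l - (l : ℂ) • H j (l - 1) := by
      simp only [hH, itoHermite, smul_eq_C_mul, C_mul, C_sub, C_neg, map_natCast]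
      ring
    have hderiv : derivative (H j l) = (j : ℂ) • H (j - 1) l + (l : ℂ) • H j (l - 1) := by
      rw [hH, derivative_itoHermite (by simp) (by simp)]
      simp only [smul_eq_C_mul, map_natCast]
    rw [hsplit, map_sub, map_add, gaussFourier_X_add_C_mul, hderiv]
    simp only [map_add, map_smul, smul_eq_mul]
    ring

theorem eval_aeval_laguerre (a M : ℕ) (u : ℝ) :
    (aeval ((X + C (I * (d : ℂ))) * (X - C (I * (d : ℂ)))) (laguerre a M)).eval (u : ℂ) =
      (((laguerre a M).eval (u ^ 2 + d ^ 2) : ℝ) : ℂ) := by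
  have hmul : (u + I * d) * (u - I * d) = ((u ^ 2 + d ^ 2 : ℝ) : ℂ) := by
    push_cast
    linear_combination (-(d : ℂ) ^ 2) * I_sq
  have h := (aeval_algHom_apply ((aeval (u : ℂ)).restrictScalars ℝ)
    ((X + C (I * (d : ℂ))) * (X - C (I * (d : ℂ)))) (laguerre a M)).symm
  simp only [AlgHom.coe_restrictScalars', coe_aeval_eq_eval, eval_mul, eval_add, eval_sub, eval_X,
    eval_C, hmul] at h
  exact h.trans (aeval_algebraMap_apply_eq_algebraMap_eval _ _)

theorem integrable_gaussWave_mul_laguerre (a M : ℕ) :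
    Integrable (fun u : ℝ => gaussWave η u * (((laguerre a M).eval (u ^ 2 + d ^ 2) : ℝ) : ℂ)) := by
  simp_rw [← eval_aeval_laguerre]
  exact integrable_gaussWave_mul_eval η _

theorem gaussFourier_aeval_laguerre (j : ℕ) :
    gaussFourier η (aeval ((X + C (I * (d : ℂ))) * (X - C (I * (d : ℂ)))) (laguerre 0 j)) =
      (j.factorial : ℂ)⁻¹ * aeval ((η : ℂ) - d) (hermite j) * aeval ((η : ℂ) + d) (hermite j) *
        gaussFourier η 1 := by
  have hito := itoHermite_eq_aeval_laguerre (X + C (I * (d : ℂ))) (X - C (I * (d : ℂ))) j 0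
  have hscalar : ((-1) ^ j * (j.factorial : ℂ[X]) * (X - C (I * (d : ℂ))) ^ 0) =
      C ((-1) ^ j * (j.factorial : ℂ)) := by simp
  rw [add_zero, hscalar, ← smul_eq_C_mul] at hito
  have h := gaussFourier_itoHermite η d j j
  rw [hito, map_smul, smul_eq_mul, ← two_mul, pow_mul, neg_sq, I_sq] at h
  have hfact : (j.factorial : ℂ) ≠ 0 := Nat.cast_ne_zero.2 j.factorial_ne_zero
  have hsign : ((-1 : ℂ) ^ j) ≠ 0 := pow_ne_zero _ (neg_ne_zero.2 one_ne_zero)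
  rw [mul_assoc, mul_assoc, mul_assoc] at h
  rw [(eq_inv_mul_iff_mul_eq₀ hfact).2 (mul_left_cancel₀ hsign h)]
  ring

theorem integral_gaussWave_mul_laguerre (j : ℕ) :
    ∫ u : ℝ, gaussWave η u * (((laguerre 0 j).eval (u ^ 2 + d ^ 2) : ℝ) : ℂ) =
      ((√(2 * Real.pi) * Real.exp (-(1 / 2) * η ^ 2) * (j.factorial : ℝ)⁻¹ *
        aeval (η - d) (hermite j) * aeval (η + d) (hermite j) : ℝ) : ℂ) := by
  have hcast (x : ℝ) : ((aeval x (hermite j) : ℝ) : ℂ) = aeval (x : ℂ) (hermite j) :=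
    (aeval_algebraMap_apply ℂ x (hermite j)).symm
  have h := gaussFourier_aeval_laguerre η d j
  simp only [gaussFourier_apply η (aeval _ _), eval_aeval_laguerre, gaussFourier_one] at h
  rw [h]
  simp only [ofReal_mul, hcast, ofReal_sub, ofReal_add, ofReal_inv, ofReal_natCast]
  ring

end GaussFourier

section WirtingerDerivatives

variable {E F : Type*} [NormedAddCommGroup E] [NormedSpace ℝ E] [NormedSpace ℂ E]
  [NormedAddCommGroup F] [NormedSpace ℝ F] [NormedSpace ℂ F]

/-- The Wirtinger derivative of `f` along `v`, that is, the value at `v` of the `ℂ`-antilinear part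
of the real derivative of `f`. On `ℂⁿ`, `dbar r` is the derivative along the basis vector `e_r`. -/
def dbarAlong (v : E) (f : E → ℂ) (z : E) : ℂ :=
  (1 / 2) * (fderiv ℝ f z v + I * fderiv ℝ f z (I • v))

theorem dbar_eq_dbarAlong {n : ℕ} (r : Fin n) (f : (Fin n → ℂ) → ℂ) :
    dbar r f = dbarAlong (Pi.single r 1) f := by
  ext z
  rw [dbar, dbarAlong, ← Pi.single_smul, smul_eq_mul, mul_one]

theorem contDiff_dbarAlong (v : E) {f : E → ℂ} (hf : ContDiff ℝ ∞ f) :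
    ContDiff ℝ ∞ (dbarAlong v f) := by
  have hf' : ContDiff ℝ ∞ (fderiv ℝ f) := hf.fderiv_right (by simp)
  exact contDiff_const.mul ((hf'.clm_apply contDiff_const).add
    (contDiff_const.mul (hf'.clm_apply contDiff_const)))

theorem fderiv_dbarAlong (v : E) {f : E → ℂ} {z : E} (hf : DifferentiableAt ℝ (fderiv ℝ f) z)
    (u : E) : fderiv ℝ (dbarAlong v f) z u =
      (1 / 2) * (fderiv ℝ (fderiv ℝ f) z u v + I * fderiv ℝ (fderiv ℝ f) z u (I • v)) := by
  have hasFDerivAt_apply (w : E) :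
      HasFDerivAt (fun z => fderiv ℝ f z w) ((fderiv ℝ (fderiv ℝ f) z).flip w) z := by
    simpa using hf.hasFDerivAt.clm_apply (hasFDerivAt_const w z)
  have h : HasFDerivAt (dbarAlong v f) _ z :=
    ((hasFDerivAt_apply v).add ((hasFDerivAt_apply (I • v)).const_mul I)).const_mul (1 / 2 : ℂ)
  rw [h.fderiv]
  rfl

theorem dbarAlong_comm (v w : E) {f : E → ℂ} (hf : ContDiff ℝ ∞ f) :
    dbarAlong v (dbarAlong w f) = dbarAlong w (dbarAlong v f) := by
  have hdiff : Differentiable ℝ (fderiv ℝ f) :=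
    ContDiff.differentiable (hf.fderiv_right (m := ∞) (by simp)) (by simp)
  ext z
  have hsymm : IsSymmSndFDerivAt ℝ f z := hf.contDiffAt.isSymmSndFDerivAt
    (by simpa using WithTop.coe_le_coe.2 (le_top : (2 : ℕ∞) ≤ ⊤))
  rw [dbarAlong, dbarAlong, fderiv_dbarAlong w (hdiff z), fderiv_dbarAlong w (hdiff z),
    fderiv_dbarAlong v (hdiff z), fderiv_dbarAlong v (hdiff z), hsymm v w, hsymm v (I • w),
    hsymm (I • v) w, hsymm (I • v) (I • w)]
  ring

theorem dbarAlong_add (v : E) {f g : E → ℂ} (hf : Differentiable ℝ f) (hg : Differentiable ℝ g) :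
    dbarAlong v (f + g) = dbarAlong v f + dbarAlong v g := by
  ext z
  simp only [dbarAlong, Pi.add_apply, fderiv_add (hf z) (hg z), add_apply]
  ring

theorem dbarAlong_mul (v : E) {f g : E → ℂ} (hf : Differentiable ℝ f) (hg : Differentiable ℝ g) :
    dbarAlong v (f * g) = dbarAlong v f * g + f * dbarAlong v g := by
  ext z
  simp only [dbarAlong, Pi.add_apply, Pi.mul_apply, fderiv_mul (hf z) (hg z), add_apply,
    smul_apply, smul_eq_mul]
  ring

theorem dbarAlong_sum_left {ι : Type*} (s : Finset ι) (v : ι → E) (f : E → ℂ) (z : E) :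
    dbarAlong (∑ i ∈ s, v i) f z = ∑ i ∈ s, dbarAlong (v i) f z := by
  simp only [dbarAlong, Finset.smul_sum, map_sum, Finset.mul_sum, ← Finset.sum_add_distrib]

variable [IsScalarTower ℝ ℂ E] [IsScalarTower ℝ ℂ F]

theorem dbarAlong_smul_left (c : ℂ) (v : E) (f : E → ℂ) (z : E) :
    dbarAlong (c • v) f z = conj c * dbarAlong v f z := by
  have hc : c • v = c.re • v + c.im • I • v := by
    rw [← smul_assoc, ← algebraMap_smul ℂ c.re v, ← add_smul]
    simp [re_add_im]
  have hIc : I • c • v = c.re • I • v - c.im • v := by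
    rw [← smul_assoc, ← smul_assoc, ← algebraMap_smul ℂ c.im v, ← sub_smul]
    congr 1
    simp [Complex.ext_iff]
  have hconj : conj c = c.re - c.im * I := by simp [Complex.ext_iff]
  rw [dbarAlong, dbarAlong, hc, ← hc, hIc, hc, hconj]
  simp only [map_add, map_sub, map_smul, real_smul]
  linear_combination (1 / 2 * (c.im * fderiv ℝ f z (I • v))) * I_sq

theorem dbarAlong_eq_sum {n : ℕ} (w : Fin n → ℂ) (f : (Fin n → ℂ) → ℂ) (z : Fin n → ℂ) :
    dbarAlong w f z = ∑ r, conj (w r) * dbar r f z := by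
  have hw : w = ∑ r, w r • (Pi.single r 1 : Fin n → ℂ) := by
    simpa [← Pi.single_smul] using (Finset.univ_sum_single w).symm
  conv_lhs => rw [hw]
  simp only [dbarAlong_sum_left, dbarAlong_smul_left, dbar_eq_dbarAlong]

theorem dbarAlong_of_differentiable (v : E) {f : E → ℂ} (hf : Differentiable ℂ f) :
    dbarAlong v f = 0 := by
  ext z
  rw [dbarAlong, ((hf z).hasFDerivAt.restrictScalars ℝ).fderiv,
    ContinuousLinearMap.coe_restrictScalars', map_smul, smul_eq_mul, Pi.zero_apply]
  linear_combination (1 / 2 * fderiv ℂ f z v) * I_sq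

theorem differentiable_of_dbarAlong_one {g : ℂ → ℂ} (hg : Differentiable ℝ g)
    (h : dbarAlong 1 g = 0) : Differentiable ℂ g := fun z => by
  have hz : (1 / 2) * (fderiv ℝ g z 1 + I * fderiv ℝ g z (I • 1)) = 0 := congrFun h z
  rw [differentiableAt_complex_iff_differentiableAt_real]
  refine ⟨hg z, ?_⟩
  rw [smul_eq_mul, mul_one] at hz
  rw [smul_eq_mul]
  linear_combination (-2 * I) * hz + fderiv ℝ g z I * I_sq

theorem dbarAlong_comp_affine (v : E) {f : F → ℂ} (hf : Differentiable ℝ f) (A : E →L[ℂ] F)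
    (b : F) : dbarAlong v (fun z => f (A z + b)) = fun z => dbarAlong (A v) f (A z + b) := by
  ext z
  have h : HasFDerivAt (fun z => f (A z + b)) _ z :=
    (hf (A z + b)).hasFDerivAt.comp z ((A.restrictScalars ℝ).hasFDerivAt.add_const b)
  simp [dbarAlong, h.fderiv]

theorem contDiff_conj_clm_add_const (L : E →L[ℂ] ℂ) (b : ℂ) :
    ContDiff ℝ ∞ (fun z => conj (L z + b)) :=
  conjCLE.contDiff.comp ((L.restrictScalars ℝ).contDiff.add contDiff_const)

theorem dbarAlong_conj_clm_add_const (v : E) (L : E →L[ℂ] ℂ) (b : ℂ) :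
    dbarAlong v (fun z => conj (L z + b)) = fun _ => conj (L v) := by
  ext z
  have h : HasFDerivAt (fun z => conj (L z + b)) _ z :=
    (conjCLE : ℂ →L[ℝ] ℂ).hasFDerivAt.comp z ((L.restrictScalars ℝ).hasFDerivAt.add_const b)
  simp only [dbarAlong, h.fderiv, ContinuousLinearMap.comp_apply,
    ContinuousLinearMap.coe_restrictScalars', map_smul, smul_eq_mul]
  change 1 / 2 * (conj (L v) + I * conj (I * L v)) = conj (L v)
  rw [map_mul, conj_I]
  linear_combination (-1 / 2 * conj (L v)) * I_sq

end WirtingerDerivatives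

section Polyanalytic

variable {n m : ℕ} {f : (Fin n → ℂ) → ℂ}

theorem contDiff_dbar (r : Fin n) (hf : ContDiff ℝ ∞ f) : ContDiff ℝ ∞ (dbar r f) := by
  rw [dbar_eq_dbarAlong]
  exact contDiff_dbarAlong _ hf

theorem contDiff_iterate_dbar (r : Fin n) (i : ℕ) (hf : ContDiff ℝ ∞ f) :
    ContDiff ℝ ∞ ((dbar r)^[i] f) :=
  Function.Iterate.rec (ContDiff ℝ ∞) hf (fun _ => contDiff_dbar r) i

theorem iterate_dbar_comm (r s : Fin n) (i : ℕ) (hf : ContDiff ℝ ∞ f) :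
    (dbar r)^[i] (dbar s f) = dbar s ((dbar r)^[i] f) := by
  induction i with
  | zero => rfl
  | succ i ih =>
    rw [Function.iterate_succ_apply', ih, Function.iterate_succ_apply']
    simpa only [dbar_eq_dbarAlong] using dbarAlong_comm _ _ (contDiff_iterate_dbar r i hf)

theorem contDiff_foldr_dbar (l : List (Fin n)) (k : Fin n → ℕ) (hf : ContDiff ℝ ∞ f) :
    ContDiff ℝ ∞ (l.foldr (fun r g => (dbar r)^[k r] g) f) := by
  induction l with
  | nil => exact hf
  | cons r l ih => exact contDiff_iterate_dbar r _ ih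

theorem foldr_dbar_comm (l : List (Fin n)) (k : Fin n → ℕ) (s : Fin n) (hf : ContDiff ℝ ∞ f) :
    l.foldr (fun r g => (dbar r)^[k r] g) (dbar s f) =
      dbar s (l.foldr (fun r g => (dbar r)^[k r] g) f) := by
  induction l with
  | nil => rfl
  | cons r l ih =>
    rw [List.foldr_cons, ih, iterate_dbar_comm r s _ (contDiff_foldr_dbar l k hf), List.foldr_cons]

theorem foldr_dbar_add_single_of_notMem (l : List (Fin n)) (k : Fin n → ℕ) {s : Fin n}
    (hs : s ∉ l) (f : (Fin n → ℂ) → ℂ) :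
    l.foldr (fun r g => (dbar r)^[(k + Pi.single s 1 : Fin n → ℕ) r] g) f =
      l.foldr (fun r g => (dbar r)^[k r] g) f :=
  List.foldr_ext _ _ _ fun r hr g => by
    rw [Pi.add_apply, Pi.single_eq_of_ne (ne_of_mem_of_not_mem hr hs), add_zero]

theorem foldr_dbar_add_single_of_mem {l : List (Fin n)} (hl : l.Nodup) (k : Fin n → ℕ) {s : Fin n}
    (hs : s ∈ l) (hf : ContDiff ℝ ∞ f) :
    l.foldr (fun r g => (dbar r)^[(k + Pi.single s 1 : Fin n → ℕ) r] g) f =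
      l.foldr (fun r g => (dbar r)^[k r] g) (dbar s f) := by
  induction l with
  | nil => simp at hs
  | cons r l ih =>
    rw [List.nodup_cons] at hl
    rw [List.foldr_cons, List.foldr_cons]
    obtain rfl | hsl := List.mem_cons.1 hs
    · rw [foldr_dbar_add_single_of_notMem l k hl.1, foldr_dbar_comm l k s hf, Pi.add_apply,
        Pi.single_eq_same, Function.iterate_succ_apply]
    · rw [ih hl.2 hsl, Pi.add_apply, Pi.single_eq_of_ne (ne_of_mem_of_not_mem hsl hl.1).symm,
        add_zero]

theorem dbarPow_add_single (k : Fin n → ℕ) (s : Fin n) (hf : ContDiff ℝ ∞ f) :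
    dbarPow (k + Pi.single s 1) f = dbarPow k (dbar s f) :=
  foldr_dbar_add_single_of_mem (List.nodup_finRange n) k (List.mem_finRange s) hf

theorem dbarPow_zero (f : (Fin n → ℂ) → ℂ) : dbarPow 0 f = f := by
  simp [dbarPow]

theorem isPolyanalytic_zero_iff : IsPolyanalytic 0 f ↔ f = 0 := by
  constructor
  · rintro ⟨-, hf⟩
    simpa [dbarPow_zero, funext_iff] using hf 0 (by simp)
  · rintro rfl
    refine ⟨contDiff_const, fun k hk z => ?_⟩
    obtain rfl : k = 0 := by simpa [funext_iff] using hk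
    rw [dbarPow_zero, Pi.zero_apply]

theorem isPolyanalytic_succ_iff :
    IsPolyanalytic (m + 1) f ↔ ContDiff ℝ ∞ f ∧ ∀ r, IsPolyanalytic m (dbar r f) := by
  constructor
  · refine fun hf => ⟨hf.1, fun r => ⟨contDiff_dbar r hf.1, fun k hk z => ?_⟩⟩
    rw [← dbarPow_add_single k r hf.1]
    exact hf.2 _ (by simp [Finset.sum_add_distrib, hk]) z
  · refine fun ⟨hf, hdbar⟩ => ⟨hf, fun k hk z => ?_⟩
    obtain ⟨s, -, hs⟩ := Finset.exists_ne_zero_of_sum_ne_zero (hk.trans_ne m.succ_ne_zero)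
    have hsplit : k - Pi.single s 1 + Pi.single s 1 = k :=
      tsub_add_cancel_of_le (update_le_iff.2
        ⟨Nat.one_le_iff_ne_zero.2 hs, fun _ _ => Nat.zero_le _⟩)
    rw [← hsplit, dbarPow_add_single _ s hf]
    refine (hdbar s).2 _ ?_ z
    have hsum := congrArg (fun k => ∑ r, k r) hsplit
    simp only [Pi.add_apply, Finset.sum_add_distrib, Finset.sum_pi_single', Finset.mem_univ,
      if_true, hk] at hsum
    exact Nat.succ_injective hsum

namespace IsPolyanalytic

theorem contDiff (hf : IsPolyanalytic m f) : ContDiff ℝ ∞ f := hf.1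

theorem differentiable (hf : IsPolyanalytic m f) : Differentiable ℝ f :=
  hf.contDiff.differentiable (by simp)

theorem zero (n m : ℕ) : IsPolyanalytic m (0 : (Fin n → ℂ) → ℂ) := by
  induction m with
  | zero => exact isPolyanalytic_zero_iff.2 rfl
  | succ m ih =>
    refine isPolyanalytic_succ_iff.2 ⟨contDiff_const, fun r => ?_⟩
    have hdbar := dbarAlong_of_differentiable (Pi.single r 1) (f := (0 : (Fin n → ℂ) → ℂ))
      (differentiable_const 0)
    rwa [dbar_eq_dbarAlong, hdbar]

theorem succ (hf : IsPolyanalytic m f) : IsPolyanalytic (m + 1) f := by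
  induction m generalizing f with
  | zero => exact isPolyanalytic_zero_iff.1 hf ▸ zero n 1
  | succ m ih =>
    exact isPolyanalytic_succ_iff.2
      ⟨hf.contDiff, fun r => ih ((isPolyanalytic_succ_iff.1 hf).2 r)⟩

theorem mono {k : ℕ} (hkm : k ≤ m) (hf : IsPolyanalytic k f) : IsPolyanalytic m f :=
  Nat.le_induction hf (fun _ _ => succ) m hkm

theorem one_of_contDiff (hf : ContDiff ℂ ∞ f) : IsPolyanalytic 1 f := by
  refine isPolyanalytic_succ_iff.2 ⟨hf.restrict_scalars ℝ, fun r => ?_⟩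
  rw [dbar_eq_dbarAlong, dbarAlong_of_differentiable _ (hf.differentiable (by simp))]
  exact zero n 0

theorem add {g : (Fin n → ℂ) → ℂ} (hf : IsPolyanalytic m f) (hg : IsPolyanalytic m g) :
    IsPolyanalytic m (f + g) := by
  induction m generalizing f g with
  | zero =>
    rw [isPolyanalytic_zero_iff] at *
    rw [hf, hg, add_zero]
  | succ m ih =>
    refine isPolyanalytic_succ_iff.2 ⟨hf.contDiff.add hg.contDiff, fun r => ?_⟩
    rw [dbar_eq_dbarAlong, dbarAlong_add _ hf.differentiable hg.differentiable,
      ← dbar_eq_dbarAlong, ← dbar_eq_dbarAlong]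
    exact ih ((isPolyanalytic_succ_iff.1 hf).2 r) ((isPolyanalytic_succ_iff.1 hg).2 r)

theorem sum {ι : Type*} (s : Finset ι) {g : ι → (Fin n → ℂ) → ℂ}
    (hg : ∀ i ∈ s, IsPolyanalytic m (g i)) : IsPolyanalytic m (∑ i ∈ s, g i) :=
  Finset.sum_induction g (IsPolyanalytic m) (fun _ _ => add) (zero n m) hg

theorem contDiff_mul {h : (Fin n → ℂ) → ℂ} (hh : ContDiff ℂ ∞ h) (hf : IsPolyanalytic m f) :
    IsPolyanalytic m (h * f) := by
  induction m generalizing f with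
  | zero =>
    rw [isPolyanalytic_zero_iff] at *
    rw [hf, mul_zero]
  | succ m ih =>
    have hdiff : Differentiable ℂ h := hh.differentiable (by simp)
    refine isPolyanalytic_succ_iff.2 ⟨(hh.restrict_scalars ℝ).mul hf.contDiff, fun r => ?_⟩
    rw [dbar_eq_dbarAlong, dbarAlong_mul _ (hdiff.restrictScalars ℝ) hf.differentiable,
      dbarAlong_of_differentiable _ hdiff, zero_mul, zero_add, ← dbar_eq_dbarAlong]
    exact ih ((isPolyanalytic_succ_iff.1 hf).2 r)

theorem const_mul (c : ℂ) (hf : IsPolyanalytic m f) : IsPolyanalytic m (fun z => c * f z) :=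
  hf.contDiff_mul (h := fun _ => c) contDiff_const

theorem conj_mul (hf : IsPolyanalytic m f) (L : (Fin n → ℂ) →L[ℂ] ℂ) (b : ℂ) :
    IsPolyanalytic (m + 1) (fun z => conj (L z + b) * f z) := by
  induction m generalizing f with
  | zero =>
    convert zero n 1
    simp [isPolyanalytic_zero_iff.1 hf]
  | succ m ih =>
    have hconj : ContDiff ℝ ∞ (fun z => conj (L z + b)) := contDiff_conj_clm_add_const L b
    refine isPolyanalytic_succ_iff.2 ⟨hconj.mul hf.contDiff, fun r => ?_⟩
    have hmul := dbarAlong_mul (Pi.single r 1) (hconj.differentiable (by simp)) hf.differentiable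
    rw [dbarAlong_conj_clm_add_const, ← dbar_eq_dbarAlong, ← dbar_eq_dbarAlong] at hmul
    exact hmul ▸ (hf.const_mul _).add (ih ((isPolyanalytic_succ_iff.1 hf).2 r))

theorem comp_add_right (hf : IsPolyanalytic m f) (b : Fin n → ℂ) :
    IsPolyanalytic m (fun z => f (z + b)) := by
  induction m generalizing f with
  | zero =>
    rw [isPolyanalytic_zero_iff] at *
    simp only [hf, Pi.zero_apply]
    rfl
  | succ m ih =>
    refine isPolyanalytic_succ_iff.2 ⟨hf.contDiff.comp (contDiff_id.add contDiff_const),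
      fun r => ?_⟩
    have hcomp := dbarAlong_comp_affine (Pi.single r 1) hf.differentiable
      (ContinuousLinearMap.id ℂ (Fin n → ℂ)) b
    rw [ContinuousLinearMap.id_apply, ← dbar_eq_dbarAlong, ← dbar_eq_dbarAlong] at hcomp
    exact hcomp ▸ ih ((isPolyanalytic_succ_iff.1 hf).2 r)

end IsPolyanalytic

end Polyanalytic

section ConjugateExpansions

variable {j : ℕ} {g : ℂ → ℂ}

/-- An expansion `g x = ∑_{k < j} x̄ᵏ h_k(x)` with entire coefficients `h_k`, which is the general
form of a `j`-analytic function of one variable. -/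
def HasConjExpansion (j : ℕ) (g : ℂ → ℂ) : Prop :=
  ∃ h : ℕ → ℂ → ℂ, (∀ k, Differentiable ℂ (h k)) ∧
    ∀ x, g x = ∑ k ∈ Finset.range j, conj x ^ k * h k x

theorem HasConjExpansion.sum_const_mul {ι : Type*} (s : Finset ι) (c : ι → ℂ) {g : ι → ℂ → ℂ}
    (hg : ∀ i, HasConjExpansion j (g i)) :
    HasConjExpansion j (fun x => ∑ i ∈ s, c i * g i x) := by
  choose h hdiff hexp using hg
  refine ⟨fun k x => ∑ i ∈ s, c i * h i k x,
    fun k => Differentiable.fun_sum fun i _ => (hdiff i k).const_mul _, fun x => ?_⟩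
  simp only [hexp, Finset.mul_sum]
  rw [Finset.sum_comm]
  exact Finset.sum_congr rfl fun k _ => Finset.sum_congr rfl fun i _ => mul_left_comm _ _ _

theorem differentiable_conj_pow_mul (k : ℕ) {h : ℂ → ℂ} (hh : Differentiable ℂ h) :
    Differentiable ℝ (fun x => conj x ^ k * h x) :=
  (conjCLE.differentiable.pow k).mul (hh.restrictScalars ℝ)

theorem dbarAlong_one_conj_pow_succ_mul (k : ℕ) {h : ℂ → ℂ} (hh : Differentiable ℂ h) :
    dbarAlong 1 (fun x => conj x ^ (k + 1) * h x) = fun x => (k + 1) * (conj x ^ k * h x) := by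
  have hconj : dbarAlong 1 (fun x : ℂ => conj x) = fun _ => 1 := by
    simpa using dbarAlong_conj_clm_add_const 1 (ContinuousLinearMap.id ℂ ℂ) 0
  have hpow (k : ℕ) :
      dbarAlong 1 (fun x : ℂ => conj x ^ (k + 1)) = fun x : ℂ => (k + 1 : ℂ) * conj x ^ k := by
    induction k with
    | zero => simpa using hconj
    | succ k ih =>
      have hmul := dbarAlong_mul 1 (f := fun x : ℂ => conj x ^ (k + 1)) (g := fun x => conj x)
        (conjCLE.differentiable.pow (k + 1)) conjCLE.differentiable
      rw [ih, hconj] at hmul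
      ext x
      refine (congrFun hmul x).trans ?_
      simp only [Pi.add_apply, Pi.mul_apply]
      push_cast
      ring
  ext x
  refine (congrFun (dbarAlong_mul 1 (f := fun x : ℂ => conj x ^ (k + 1))
    (conjCLE.differentiable.pow (k + 1)) (hh.restrictScalars ℝ)) x).trans ?_
  rw [hpow, dbarAlong_of_differentiable 1 hh, mul_zero, add_zero]
  exact mul_assoc _ _ _

theorem exists_dbarAlong_one_eq_sum {h : ℕ → ℂ → ℂ} (hh : ∀ k, Differentiable ℂ (h k)) (j : ℕ) :
    Differentiable ℝ (fun x => ∑ k ∈ Finset.range j, conj x ^ (k + 1) * ((k + 1 : ℂ)⁻¹ * h k x)) ∧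
      dbarAlong 1 (fun x => ∑ k ∈ Finset.range j, conj x ^ (k + 1) * ((k + 1 : ℂ)⁻¹ * h k x)) =
        fun x => ∑ k ∈ Finset.range j, conj x ^ k * h k x := by
  induction j with
  | zero =>
    simp only [Finset.range_zero, Finset.sum_empty]
    exact ⟨differentiable_const _, dbarAlong_of_differentiable 1 (differentiable_const 0)⟩
  | succ j ih =>
    have hterm : Differentiable ℂ (fun x => (j + 1 : ℂ)⁻¹ * h j x) := (hh j).const_mul _
    simp only [Finset.sum_range_succ]
    refine ⟨ih.1.add (differentiable_conj_pow_mul _ hterm), ?_⟩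
    refine (dbarAlong_add 1 ih.1 (differentiable_conj_pow_mul _ hterm)).trans ?_
    rw [ih.2, dbarAlong_one_conj_pow_succ_mul j hterm]
    ext x
    have hj : (j + 1 : ℂ) ≠ 0 := by exact_mod_cast j.succ_ne_zero
    simp only [Pi.add_apply]
    field_simp

theorem HasConjExpansion.of_dbarAlong (hg : Differentiable ℝ g)
    (h : HasConjExpansion j (dbarAlong 1 g)) : HasConjExpansion (j + 1) g := by
  obtain ⟨h, hdiff, hexp⟩ := h
  obtain ⟨hPdiff, hPdbar⟩ := exists_dbarAlong_one_eq_sum hdiff j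
  set P : ℂ → ℂ := fun x => ∑ k ∈ Finset.range j, conj x ^ (k + 1) * ((k + 1 : ℂ)⁻¹ * h k x)
  have hholo : Differentiable ℂ (g - P) := by
    refine differentiable_of_dbarAlong_one (hg.sub hPdiff) ?_
    have hadd := dbarAlong_add 1 (hg.sub hPdiff) hPdiff
    rw [sub_add_cancel, hPdbar, ← funext hexp] at hadd
    exact right_eq_add.1 hadd
  refine ⟨fun k => k.casesOn (g - P) fun k x => (k + 1 : ℂ)⁻¹ * h k x, fun k => ?_, fun x => ?_⟩
  · cases k with
    | zero => exact hholo
    | succ k => exact (hdiff k).const_mul _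
  · rw [Finset.sum_range_succ', pow_zero, one_mul]
    exact (add_sub_cancel (P x) (g x)).symm

theorem IsPolyanalytic.hasConjExpansion_ray {n : ℕ} {G : (Fin n → ℂ) → ℂ}
    (hG : IsPolyanalytic j G) (w : Fin n → ℂ) : HasConjExpansion j (fun x => G (x • w)) := by
  induction j generalizing G with
  | zero =>
    rw [isPolyanalytic_zero_iff] at hG
    exact ⟨fun _ _ => 0, fun _ => differentiable_const _, fun x => by simp [hG]⟩
  | succ j ih =>
    have hdbar : dbarAlong 1 (fun x : ℂ => G (x • w)) =
        fun x => ∑ r, conj (w r) * dbar r G (x • w) := by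
      simpa [dbarAlong_eq_sum] using dbarAlong_comp_affine 1 hG.differentiable
        (ContinuousLinearMap.toSpanSingleton ℂ w) 0
    refine .of_dbarAlong (hG.differentiable.comp (differentiable_id.smul_const w)) ?_
    rw [hdbar]
    exact .sum_const_mul _ _ fun r => ih ((isPolyanalytic_succ_iff.1 hG).2 r)

theorem circleAverage_conj_pow_mul (k : ℕ) {h : ℂ → ℂ} (hh : Differentiable ℂ h) {ρ : ℝ}
    (hρ : 0 < ρ) : Real.circleAverage (fun x => conj x ^ k * h x) 0 ρ =
      (k.factorial : ℂ)⁻¹ * iteratedDeriv k h 0 * (ρ : ℂ) ^ (2 * k) := by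
  have hcauchy := (hh.differentiableOn (s := Metric.closedBall 0
    ρ)).circleIntegral_one_div_sub_center_pow_smul hρ k
  have hsphere : Set.EqOn (fun x => x⁻¹ • (conj x ^ k * h x))
      (fun x => ((ρ : ℂ) ^ 2) ^ k * ((1 / (x - 0) ^ (k + 1)) • h x)) (Metric.sphere 0 ρ) := by
    intro x hx
    have hnorm : ‖x‖ = ρ := mem_sphere_zero_iff_norm.1 hx
    have hx0 : x ≠ 0 := norm_pos_iff.1 (hnorm ▸ hρ)
    have hconj : conj x = (ρ : ℂ) ^ 2 / x := by
      rw [eq_div_iff hx0, ← hnorm, conj_mul']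
    simp only [hconj, sub_zero, smul_eq_mul, div_pow]
    field_simp
    ring
  rw [Real.circleAverage_eq_circleIntegral hρ.ne']
  simp only [sub_zero]
  rw [circleIntegral.integral_congr hρ.le hsphere, circleIntegral.integral_const_mul, hcauchy,
    smul_eq_mul, smul_eq_mul]
  field_simp
  ring

theorem HasConjExpansion.exists_circleAverage_eq_sum (hg : HasConjExpansion (j + 1) g) :
    ∃ c : ℕ → ℂ, c 0 = g 0 ∧ ∀ ρ : ℝ, 0 < ρ →
      Real.circleAverage g 0 ρ = ∑ k ∈ Finset.range (j + 1), c k * (ρ : ℂ) ^ (2 * k) := by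
  obtain ⟨h, hdiff, hexp⟩ := hg
  refine ⟨fun k => (k.factorial : ℂ)⁻¹ * iteratedDeriv k (h k) 0, ?_, fun ρ hρ => ?_⟩
  · simp [hexp, Finset.sum_range_succ']
  · rw [funext hexp, Real.circleAverage_fun_sum fun k _ =>
      (differentiable_conj_pow_mul k (hdiff k)).continuous.continuousOn.circleIntegrable hρ.le]
    exact Finset.sum_congr rfl fun k _ => circleAverage_conj_pow_mul k (hdiff k) hρ

end ConjugateExpansions

section RadialIntegrals

theorem integrableOn_pow_mul_exp_neg_mul_sq {σ : ℝ} (hσ : 0 < σ) (p : ℕ) :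
    IntegrableOn (fun r : ℝ => r ^ p * Real.exp (-σ * r ^ 2)) (Set.Ioi 0) := by
  simpa using integrableOn_rpow_mul_exp_neg_mul_sq hσ (s := p)
    (neg_one_lt_zero.trans_le p.cast_nonneg)

theorem integral_pow_mul_exp_neg_mul_sq {σ : ℝ} (hσ : 0 < σ) (p : ℕ) :
    ∫ r in Set.Ioi (0 : ℝ), r ^ (2 * p + 1) * Real.exp (-σ * r ^ 2) =
      p.factorial / (2 * σ ^ (p + 1)) := by
  have h := _root_.integral_rpow_mul_exp_neg_mul_rpow (p := 2) (q := (2 * p + 1 : ℕ)) two_pos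
    (neg_one_lt_zero.trans_le (Nat.cast_nonneg _)) hσ
  have hexponent : (((2 * p + 1 : ℕ) : ℝ) + 1) / 2 = p + 1 := by push_cast; ring
  rw [neg_div, hexponent, Real.Gamma_nat_eq_factorial, Real.rpow_neg hσ.le] at h
  norm_cast at h
  rw [h]
  field_simp

theorem pow_mul_laguerre_mul_exp_eq_sum (N M k : ℕ) (σ r : ℝ) :
    r ^ (2 * N + 1) * (r ^ (2 * k) * ((laguerre (N + 1) M).eval (σ * r ^ 2) *
        Real.exp (-σ * r ^ 2))) =
      ∑ i ∈ Finset.range (M + 1),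
        (-1) ^ i * ((M + (N + 1)).choose (N + 1 + i) : ℝ) / (i.factorial : ℝ) * σ ^ i *
          (r ^ (2 * (N + k + i) + 1) * Real.exp (-σ * r ^ 2)) := by
  rw [eval_laguerre, Finset.sum_mul, Finset.mul_sum, Finset.mul_sum]
  exact Finset.sum_congr rfl fun i _ => by ring

theorem integrableOn_pow_mul_laguerre (N M k : ℕ) {σ : ℝ} (hσ : 0 < σ) :
    IntegrableOn (fun r : ℝ => r ^ (2 * N + 1) * (r ^ (2 * k) *
      ((laguerre (N + 1) M).eval (σ * r ^ 2) * Real.exp (-σ * r ^ 2)))) (Set.Ioi 0) := by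
  simp only [pow_mul_laguerre_mul_exp_eq_sum]
  exact integrable_finsetSum _ fun i _ => (integrableOn_pow_mul_exp_neg_mul_sq hσ _).const_mul _

theorem integral_pow_mul_laguerre (N : ℕ) {M k : ℕ} (hk : k ≤ M) {σ : ℝ} (hσ : 0 < σ) :
    ∫ r in Set.Ioi (0 : ℝ), r ^ (2 * N + 1) * (r ^ (2 * k) *
      ((laguerre (N + 1) M).eval (σ * r ^ 2) * Real.exp (-σ * r ^ 2))) =
      if k = 0 then N.factorial / (2 * σ ^ (N + 1)) else 0 := by
  have hterm (i : ℕ) :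
      (-1) ^ i * ((M + (N + 1)).choose (N + 1 + i) : ℝ) / (i.factorial : ℝ) * σ ^ i *
        ((N + k + i).factorial / (2 * σ ^ (N + k + i + 1))) =
      (N + k).factorial / (2 * σ ^ (N + k + 1)) *
        ((-1) ^ i * ((M + (N + 1)).choose (N + 1 + i) : ℝ) * (N + k + i).choose (N + k)) := by
    have hchoose : ((N + k + i).choose (N + k) : ℝ) * (N + k).factorial * i.factorial =
        (N + k + i).factorial := by
      rw [Nat.choose_symm_add]
      exact_mod_cast Nat.add_choose_mul_factorial_mul_factorial (N + k) i
    rw [← hchoose, show N + k + i + 1 = i + (N + k + 1) by omega, pow_add σ i]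
    have : (i.factorial : ℝ) ≠ 0 := by positivity
    field_simp
  simp only [pow_mul_laguerre_mul_exp_eq_sum]
  rw [integral_finsetSum _ fun i _ => (integrableOn_pow_mul_exp_neg_mul_sq hσ _).const_mul _]
  simp only [integral_const_mul, integral_pow_mul_exp_neg_mul_sq hσ, hterm]
  rw [← Finset.mul_sum, alternating_sum_choose_mul_choose N M k hk, mul_ite, mul_one, mul_zero]
  exact if_ctx_congr Iff.rfl (by rintro rfl; rfl) fun _ => rfl

/- Averaging over circles leaves a polynomial in `r²` of degree at most `M` with constant term
`g 0`, and `laguerre (N + 1) M` is orthogonal to all its other terms. -/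
theorem HasConjExpansion.integral_circleAverage_mul_laguerre (N : ℕ) {M : ℕ} {σ : ℝ} (hσ : 0 < σ)
    {g : ℂ → ℂ} (hg : HasConjExpansion (M + 1) g) :
    ∫ r in Set.Ioi (0 : ℝ), r ^ (2 * N + 1) • (Real.circleAverage g 0 r *
      (((laguerre (N + 1) M).eval (σ * r ^ 2) * Real.exp (-σ * r ^ 2) : ℝ) : ℂ)) =
      g 0 * ((N.factorial / (2 * σ ^ (N + 1)) : ℝ) : ℂ) := by
  obtain ⟨c, hc0, hc⟩ := hg.exists_circleAverage_eq_sum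
  have hsum : Set.EqOn (fun r : ℝ => r ^ (2 * N + 1) • (Real.circleAverage g 0 r *
        (((laguerre (N + 1) M).eval (σ * r ^ 2) * Real.exp (-σ * r ^ 2) : ℝ) : ℂ)))
      (fun r => ∑ k ∈ Finset.range (M + 1), c k * ((r ^ (2 * N + 1) * (r ^ (2 * k) *
        ((laguerre (N + 1) M).eval (σ * r ^ 2) * Real.exp (-σ * r ^ 2))) : ℝ) : ℂ))
      (Set.Ioi 0) := by
    intro r hr
    simp only [hc r hr, Finset.sum_mul, Finset.smul_sum, real_smul]
    refine Finset.sum_congr rfl fun k _ => ?_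
    push_cast
    ring
  have hterm : ∀ k ∈ Finset.range (M + 1), ∫ r in Set.Ioi (0 : ℝ), c k *
        ((r ^ (2 * N + 1) * (r ^ (2 * k) * ((laguerre (N + 1) M).eval (σ * r ^ 2) *
          Real.exp (-σ * r ^ 2))) : ℝ) : ℂ) =
      if k = 0 then g 0 * ((N.factorial / (2 * σ ^ (N + 1)) : ℝ) : ℂ) else 0 := by
    intro k hk
    rw [integral_const_mul, integral_complex_ofReal,
      integral_pow_mul_laguerre N (Nat.lt_succ_iff.1 (Finset.mem_range.1 hk)) hσ]
    split_ifs with hk0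
    · rw [hk0, hc0]
    · rw [ofReal_zero, mul_zero]
  have hint : ∀ k ∈ Finset.range (M + 1), Integrable (fun r : ℝ => c k *
      ((r ^ (2 * N + 1) * (r ^ (2 * k) * ((laguerre (N + 1) M).eval (σ * r ^ 2) *
        Real.exp (-σ * r ^ 2))) : ℝ) : ℂ)) (volume.restrict (Set.Ioi 0)) :=
    fun k _ => (integrableOn_pow_mul_laguerre N M k hσ).ofReal.const_mul _
  rw [setIntegral_congr_fun measurableSet_Ioi hsum, integral_finsetSum _ hint,
    Finset.sum_congr rfl hterm, Finset.sum_ite_eq' (Finset.range (M + 1)) 0,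
    if_pos (Finset.mem_range.2 M.succ_pos)]

end RadialIntegrals

section PolarCoordinates

theorem integral_eq_integral_sphere_integral_Ioi {E F : Type*} [NormedAddCommGroup E]
    [NormedSpace ℝ E] [FiniteDimensional ℝ E] [Nontrivial E] [MeasurableSpace E] [BorelSpace E]
    [NormedAddCommGroup F] [NormedSpace ℝ F] (μ : Measure E) [μ.IsAddHaarMeasure] {f : E → F}
    (hf : Integrable f μ) :
    ∫ w, f w ∂μ = ∫ x : Metric.sphere (0 : E) 1,
      (∫ r in Set.Ioi (0 : ℝ), r ^ (Module.finrank ℝ E - 1) • f (r • (x : E))) ∂μ.toSphere := by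
  set g : Metric.sphere (0 : E) 1 × Set.Ioi (0 : ℝ) → F := fun p => f ((p.2 : ℝ) • (p.1 : E))
  have hcomp : g ∘ homeomorphUnitSphereProd E = f ∘ Subtype.val := by
    ext w
    have hw := congrArg Subtype.val ((homeomorphUnitSphereProd E).symm_apply_apply w)
    rw [homeomorphUnitSphereProd_symm_apply_coe] at hw
    exact congrArg f hw
  have hpres := μ.measurePreserving_homeomorphUnitSphereProd
  have hemb := (homeomorphUnitSphereProd E).measurableEmbedding
  have hg : Integrable g (μ.toSphere.prod (.volumeIoiPow (Module.finrank ℝ E - 1))) := by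
    rw [← hpres.integrable_comp_emb hemb, hcomp,
      ← integrableOn_iff_comap_subtypeVal (measurableSet_singleton _).compl]
    exact hf.integrableOn
  calc ∫ w, f w ∂μ = ∫ w : ({0}ᶜ : Set E), (f ∘ Subtype.val) w ∂μ.comap (↑) := by
        rw [Function.comp_def, integral_subtype_comap (measurableSet_singleton _).compl,
          restrict_compl_singleton]
    _ = ∫ p, g p ∂μ.toSphere.prod (.volumeIoiPow (Module.finrank ℝ E - 1)) := by
        rw [← hcomp, ← hpres.integral_comp hemb]
        rfl
    _ = _ := by
        rw [integral_prod _ hg]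
        refine integral_congr_ae (.of_forall fun x => ?_)
        simp only [Measure.volumeIoiPow, ENNReal.ofReal]
        rw [integral_withDensity_eq_integral_smul (by fun_prop),
          integral_subtype_comap measurableSet_Ioi fun r : ℝ =>
            Real.toNNReal (r ^ (Module.finrank ℝ E - 1)) • f (r • (x : E))]
        refine setIntegral_congr_fun measurableSet_Ioi fun r hr => ?_
        simp only [NNReal.smul_def, Real.coe_toNNReal _ (pow_nonneg (le_of_lt hr) _)]

variable {E F : Type*} [NormedAddCommGroup E] [NormedSpace ℂ E] [MeasurableSpace E] [BorelSpace E]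
  [SecondCountableTopology E] [NormedAddCommGroup F] {μ : Measure E} [SFinite μ]
  [SMulInvariantMeasure Circle E μ] {f : E → F}

theorem integrable_uncurry_circleMap_smul (hfc : Continuous f) (hf : Integrable f μ) :
    Integrable (Function.uncurry fun (w : E) (θ : ℝ) => f (circleMap 0 1 θ • w))
      (μ.prod (volume.restrict (Set.Ioc 0 (2 * Real.pi)))) := by
  have hrot (θ : ℝ) (w : E) : circleMap 0 1 θ • w = Circle.exp θ • w := by
    simp [circleMap, Circle.smul_def]
  have hmeas : AEStronglyMeasurable
      (Function.uncurry fun (w : E) (θ : ℝ) => f (circleMap 0 1 θ • w))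
      (μ.prod (volume.restrict (Set.Ioc 0 (2 * Real.pi)))) :=
    Continuous.aestronglyMeasurable (hfc.comp (by fun_prop))
  rw [integrable_prod_iff' hmeas]
  simp only [Function.uncurry_apply_pair, hrot]
  refine ⟨.of_forall fun θ => ?_, ?_⟩
  · exact ((measurePreserving_smul _ μ).integrable_comp_emb (measurableEmbedding_const_smul _)).2 hf
  · simp only [integral_smul_eq_self (fun w => ‖f w‖)]
    exact integrable_const _

variable [NormedSpace ℝ F]

theorem integrable_circleAverage_smul (hfc : Continuous f) (hf : Integrable f μ) :
    Integrable (fun w => Real.circleAverage (fun x => f (x • w)) 0 1) μ := by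
  simp only [Real.circleAverage, intervalIntegral.integral_of_le Real.two_pi_pos.le]
  exact (integrable_uncurry_circleMap_smul hfc hf).integral_prod_left.smul _

theorem integral_circleAverage_smul [CompleteSpace F] (hfc : Continuous f) (hf : Integrable f μ) :
    ∫ w, Real.circleAverage (fun x => f (x • w)) 0 1 ∂μ = ∫ w, f w ∂μ := by
  have hrot (θ : ℝ) : ∫ w, f (circleMap 0 1 θ • w) ∂μ = ∫ w, f w ∂μ := by
    simpa [circleMap, Circle.smul_def] using integral_smul_eq_self (μ := μ) f (g := Circle.exp θ)
  simp only [Real.circleAverage, intervalIntegral.integral_of_le Real.two_pi_pos.le]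
  rw [integral_smul, integral_integral_swap (integrable_uncurry_circleMap_smul hfc hf)]
  simp only [hrot, integral_const, measureReal_restrict_apply_univ, Real.volume_real_Ioc, sub_zero,
    max_eq_left Real.two_pi_pos.le, inv_smul_smul₀ Real.two_pi_pos.ne']

instance (n : ℕ) : SMulInvariantMeasure Circle (Fin n → ℂ) volume where
  measure_preimage_smul c _ hs :=
    (volume_preserving_pi fun _ => (rotation c).measurePreserving).measure_preimage
      hs.nullMeasurableSet

end PolarCoordinates

section GaussianWeight

variable {n : ℕ}

/-- The squared Euclidean norm on `ℂⁿ`; the norm of `Fin n → ℂ` itself is the maximum norm. -/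
def normSqSum (w : Fin n → ℂ) : ℝ := ∑ r, ‖w r‖ ^ 2

@[fun_prop]
theorem continuous_normSqSum : Continuous (normSqSum (n := n)) := by
  unfold normSqSum
  fun_prop

theorem dotProduct_star_self (w : Fin n → ℂ) : w ⬝ᵥ star w = normSqSum w := by
  simp only [dotProduct, Pi.star_apply, RCLike.star_def, mul_conj', normSqSum, ofReal_sum,
    ofReal_pow]

theorem normSqSum_smul (c : ℂ) (w : Fin n → ℂ) : normSqSum (c • w) = ‖c‖ ^ 2 * normSqSum w := by
  simp only [normSqSum, Pi.smul_apply, smul_eq_mul, norm_mul, mul_pow, Finset.mul_sum]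

theorem normSqSum_pos {w : Fin n → ℂ} (hw : w ≠ 0) : 0 < normSqSum w := by
  obtain ⟨r, hr⟩ := Function.ne_iff.mp hw
  exact Finset.sum_pos' (fun _ _ => sq_nonneg _)
    ⟨r, Finset.mem_univ r, pow_pos (norm_pos_iff.2 hr) 2⟩

theorem exp_neg_mul_normSqSum (b : ℝ) (w : Fin n → ℂ) :
    Real.exp (-b * normSqSum w) = ∏ r, Real.exp (-b * ‖w r‖ ^ 2) := by
  rw [normSqSum, Finset.mul_sum, Real.exp_sum]

theorem integrable_exp_neg_mul_normSqSum {b : ℝ} (hb : 0 < b) :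
    Integrable (fun w : Fin n → ℂ => Real.exp (-b * normSqSum w)) := by
  simp only [exp_neg_mul_normSqSum]
  refine Integrable.fintype_prod (f := fun _ (x : ℂ) => Real.exp (-b * ‖x‖ ^ 2)) fun _ => ?_
  refine .of_integral_ne_zero ?_
  rw [GaussianFourier.integral_rexp_neg_mul_sq_norm hb]
  positivity

theorem integral_exp_neg_mul_normSqSum {b : ℝ} (hb : 0 < b) :
    ∫ w : Fin n → ℂ, Real.exp (-b * normSqSum w) = (Real.pi / b) ^ n := by
  simp only [exp_neg_mul_normSqSum]
  rw [integral_fintype_prod_volume_eq_prod (f := fun _ (x : ℂ) => Real.exp (-b * ‖x‖ ^ 2)),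
    GaussianFourier.integral_rexp_neg_mul_sq_norm hb, Finset.prod_const, Finset.card_univ,
    Fintype.card_fin, finrank_real_complex]
  norm_num

theorem integrable_eval_mul_exp_neg_mul_normSqSum (p : Polynomial ℝ) {b : ℝ} (hb : 0 < b) :
    Integrable (fun w : Fin n → ℂ => p.eval (normSqSum w) * Real.exp (-b * normSqSum w)) := by
  simp only [Polynomial.eval_eq_sum_range, Finset.sum_mul, mul_assoc]
  refine integrable_finsetSum _ fun k _ => Integrable.const_mul ?_ _
  refine ProbabilityTheory.integrable_pow_mul_exp_of_integrable_exp_mul (t := b / 2)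
    (half_pos hb).ne' ?_ ?_ k
  · rw [show -b + b / 2 = -(b / 2) by ring]
    exact integrable_exp_neg_mul_normSqSum (half_pos hb)
  · rw [show -b - b / 2 = -(b + b / 2) by ring]
    exact integrable_exp_neg_mul_normSqSum (by positivity)

end GaussianWeight

section MeanValue

variable {n m M : ℕ} {α : ℝ} {G : (Fin n → ℂ) → ℂ}

theorem continuous_of_mem_fockSpace (hG : G ∈ fockSpace n m α) : Continuous G :=
  hG.1.contDiff.continuous

theorem integrable_norm_sq_mul_exp (hG : G ∈ fockSpace n m α) :
    Integrable (fun w => ‖G w‖ ^ 2 * Real.exp (-α * normSqSum w)) :=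
  hG.2

theorem integrable_mul_eval_mul_exp (hα : 0 < α) (hG : G ∈ fockSpace n m α) (p : Polynomial ℝ) :
    Integrable (fun w => G w *
      ((p.eval (normSqSum w) * Real.exp (-α * normSqSum w) : ℝ) : ℂ)) := by
  have hcont := continuous_of_mem_fockSpace hG
  refine ((integrable_norm_sq_mul_exp hG).add
    (integrable_eval_mul_exp_neg_mul_normSqSum (p ^ 2) hα)).mono'
    (Continuous.aestronglyMeasurable (by fun_prop)) (.of_forall fun w => ?_)
  have hyoung : ‖G w‖ * |p.eval (normSqSum w)| ≤ ‖G w‖ ^ 2 + p.eval (normSqSum w) ^ 2 := by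
    rw [← sq_abs (p.eval _)]
    nlinarith [sq_nonneg (‖G w‖ - |p.eval (normSqSum w)|), sq_nonneg ‖G w‖,
      sq_nonneg |p.eval (normSqSum w)|]
  rw [norm_mul, norm_real, Real.norm_eq_abs, abs_mul, Real.abs_exp, Pi.add_apply, ← add_mul,
    ← mul_assoc, Polynomial.eval_pow]
  gcongr

theorem circleAverage_mul_normSqSum_smul (φ : ℝ → ℂ) (r : ℝ) (w : Fin n → ℂ) :
    Real.circleAverage (fun x => G (x • r • w) * φ (normSqSum (x • r • w))) 0 1 =
      Real.circleAverage (fun x => G (x • w)) 0 r * φ (normSqSum w * r ^ 2) := by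
  have hnorm (θ : ℝ) : normSqSum (circleMap 0 1 θ • r • w) = normSqSum w * r ^ 2 := by
    rw [← coe_smul, normSqSum_smul, normSqSum_smul]
    simp [mul_comm]
  have hscale (θ : ℝ) : circleMap 0 1 θ • r • w = (r * circleMap 0 1 θ + 0) • w := by
    rw [← coe_smul, smul_smul, mul_comm, add_zero]
  rw [Real.circleAverage_eq_circleAverage_zero_one (R := r)]
  simp only [Real.circleAverage, hnorm, intervalIntegral.integral_mul_const, smul_mul_assoc]
  simp only [hscale]

/- Circle averages on the complex line through each `w` of the unit sphere reduce the claim to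
`HasConjExpansion.integral_circleAverage_mul_laguerre` with `σ = α |w|²`. -/
theorem integral_mul_laguerre (hn : 1 ≤ n) (hα : 0 < α) (hG : G ∈ fockSpace n (M + 1) α) :
    ∫ w, G w * (((laguerre n M).eval (α * normSqSum w) * Real.exp (-α * normSqSum w) : ℝ) : ℂ) =
      (((Real.pi / α) ^ n : ℝ) : ℂ) * G 0 := by
  obtain ⟨N, rfl⟩ : ∃ N, n = N + 1 := ⟨n - 1, by omega⟩
  have hdim : Module.finrank ℝ (Fin (N + 1) → ℂ) - 1 = 2 * N + 1 := by
    simp only [Module.finrank_pi_fintype, finrank_real_complex, Finset.sum_const,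
      Finset.card_univ, Fintype.card_fin, smul_eq_mul]
    omega
  set φ : ℝ → ℂ := fun s =>
    (((laguerre (N + 1) M).eval (α * s) * Real.exp (-α * s) : ℝ) : ℂ) with hφ
  have hcont : Continuous fun w => G w * φ (normSqSum w) := by
    have := continuous_of_mem_fockSpace hG
    fun_prop
  have hint : Integrable fun w => G w * φ (normSqSum w) := by
    convert integrable_mul_eval_mul_exp hα hG
      ((laguerre (N + 1) M).comp (Polynomial.C α * Polynomial.X)) using 4
    rw [Polynomial.eval_comp, Polynomial.eval_C_mul, Polynomial.eval_X]
  have hexp := integrable_exp_neg_mul_normSqSum (n := N + 1) hα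
  have hray (w : Metric.sphere (0 : Fin (N + 1) → ℂ) 1) :
      ∫ r in Set.Ioi (0 : ℝ), r ^ (2 * N + 1) • Real.circleAverage (fun x =>
        G (x • r • w.1) * φ (normSqSum (x • r • w.1))) 0 1 =
      ((∫ r in Set.Ioi (0 : ℝ), r ^ (2 * N + 1) • Real.exp (-α * normSqSum (r • w.1)) : ℝ) : ℂ) *
        G 0 := by
    have hw : 0 < normSqSum w.1 := normSqSum_pos (ne_zero_of_mem_unit_sphere w)
    have hσ := mul_pos hα hw
    have hline := (hG.1.hasConjExpansion_ray w.1).integral_circleAverage_mul_laguerre N hσ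
    rw [zero_smul, mul_comm (G 0), ← integral_pow_mul_exp_neg_mul_sq hσ] at hline
    have hnorm (r : ℝ) : normSqSum (r • w.1) = normSqSum w.1 * r ^ 2 := by
      rw [← coe_smul, normSqSum_smul, norm_real, Real.norm_eq_abs, sq_abs, mul_comm]
    simp only [circleAverage_mul_normSqSum_smul φ]
    simpa only [hφ, hnorm, neg_mul, mul_assoc, smul_eq_mul] using hline
  rw [← integral_circleAverage_smul hcont hint, integral_eq_integral_sphere_integral_Ioi _
    (integrable_circleAverage_smul hcont hint), hdim, ← integral_exp_neg_mul_normSqSum hα,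
    integral_eq_integral_sphere_integral_Ioi _ hexp, hdim, ← integral_complex_ofReal,
    ← integral_mul_const]
  exact integral_congr_ae (.of_forall hray)

end MeanValue

section ReproducingKernel

variable {X Y : Type*} {H : Set (X → ℂ)} {ip : (X → ℂ) → (X → ℂ) → ℂ} {K K' : X → X → ℂ}

theorem IsReproducingKernel.unique (hip : ∀ f g, conj (ip f g) = ip g f)
    (hK : IsReproducingKernel H ip K) (hK' : IsReproducingKernel H ip K') : K = K' := by
  have hswap {L L' : X → X → ℂ} (hL : IsReproducingKernel H ip L)
      (hL' : IsReproducingKernel H ip L') (x y : X) : L' y x = conj (L x y) := by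
    rw [(hL x).2 _ (hL' y).1, (hL' y).2 _ (hL x).1, hip]
  ext y x
  rw [hswap hK hK' x y, ← hswap hK hK x y]

theorem IsReproducingKernel.weighted_comp (hK : IsReproducingKernel H ip K)
    (hH : ∀ (a : ℂ), ∀ f ∈ H, (fun x => a * f x) ∈ H)
    (hip : ∀ (a : ℂ) f g, ip f (fun x => a * g x) = conj a * ip f g)
    {ip' : (Y → ℂ) → (Y → ℂ) → ℂ} {c : Y → ℂ} {φ : Y → X}
    (hiso : ∀ f g, ip' (fun y => c y * f (φ y)) (fun y => c y * g (φ y)) = ip f g) :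
    IsReproducingKernel ((fun f y => c y * f (φ y)) '' H) ip'
      (fun y y' => c y' * (conj (c y) * K (φ y) (φ y'))) := by
  refine fun y => ⟨⟨_, hH (conj (c y)) _ (hK (φ y)).1, rfl⟩, ?_⟩
  rintro _ ⟨f, hf, rfl⟩
  rw [hiso f fun x => conj (c y) * K (φ y) x, hip, conj_conj, ← (hK (φ y)).2 f hf]

end ReproducingKernel

section FockKernel

variable {n m M : ℕ} {α : ℝ} {F G : (Fin n → ℂ) → ℂ}

theorem const_mul_mem_fockSpace (a : ℂ) (hF : F ∈ fockSpace n m α) :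
    (fun z => a * F z) ∈ fockSpace n m α := by
  refine ⟨hF.1.const_mul a, (hF.2.const_mul (‖a‖ ^ 2)).congr (.of_forall fun z => ?_)⟩
  simp only [norm_mul, mul_pow, mul_assoc]

/-- The inner product of `L²(ℂⁿ)` with respect to the Gaussian probability measure with density
`(α / π)ⁿ exp (-α |w|²)`. -/
def fockInner (α : ℝ) (F G : (Fin n → ℂ) → ℂ) : ℂ :=
  (((α / Real.pi) ^ n : ℝ) : ℂ) * ∫ w, F w * conj (G w) * (Real.exp (-α * normSqSum w) : ℂ)

theorem fockInner_const_mul_right (a : ℂ) (F G : (Fin n → ℂ) → ℂ) :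
    fockInner α F (fun w => a * G w) = conj a * fockInner α F G := by
  simp only [fockInner, map_mul, mul_left_comm _ (conj a), mul_assoc (conj a), integral_const_mul]

/-- The Weyl translation `F ↦ exp (-α ⟨·, z⟩) F (· + z)` by `z`. -/
def weylTranslate (α : ℝ) (z : Fin n → ℂ) (F : (Fin n → ℂ) → ℂ) : (Fin n → ℂ) → ℂ := fun w =>
  cexp (-α * (w ⬝ᵥ star z)) * F (w + z)

theorem ofReal_normSqSum_add (w z : Fin n → ℂ) :
    (normSqSum (w + z) : ℂ) =
      normSqSum w + normSqSum z + w ⬝ᵥ star z + conj (w ⬝ᵥ star z) := by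
  rw [starRingEnd_apply, ← Matrix.star_dotProduct_star, star_star]
  simp only [← dotProduct_star_self, star_add, add_dotProduct, dotProduct_add]
  ring

theorem normSqSum_add (w z : Fin n → ℂ) :
    normSqSum (w + z) = normSqSum w + normSqSum z + 2 * (w ⬝ᵥ star z).re := by
  have h := ofReal_normSqSum_add w z
  rw [add_assoc, add_conj] at h
  exact_mod_cast h

theorem weylTranslate_mem_fockSpace (z : Fin n → ℂ) (hF : F ∈ fockSpace n m α) :
    weylTranslate α z F ∈ fockSpace n m α := by
  refine ⟨(hF.1.comp_add_right z).contDiff_mul (by unfold dotProduct; fun_prop), ?_⟩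
  refine ((hF.2.comp_add_right z).const_mul (Real.exp (α * normSqSum z))).congr
    (.of_forall fun w => ?_)
  change _ * (_ * Real.exp (-α * normSqSum (w + z))) = _ * Real.exp (-α * normSqSum w)
  rw [weylTranslate, norm_mul, norm_exp, mul_pow, ← Real.exp_nat_mul, mul_left_comm,
    ← Real.exp_add, mul_right_comm, ← Real.exp_add, mul_comm, normSqSum_add, ← ofReal_neg,
    re_ofReal_mul]
  congr 2
  push_cast
  ring

theorem fockInner_weylTranslate_left (z : Fin n → ℂ) (F G : (Fin n → ℂ) → ℂ) :
    fockInner α (weylTranslate α z F) G = fockInner α F (weylTranslate α (-z) G) := by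
  rw [fockInner, fockInner, ← integral_add_right_eq_self
    (fun w => F w * conj (weylTranslate α (-z) G w) * (Real.exp (-α * normSqSum w) : ℂ)) z]
  congr 2 with w
  have hexp : cexp (-α * (w ⬝ᵥ star z)) * (Real.exp (-α * normSqSum w) : ℂ) =
      conj (cexp (-α * ((w + z) ⬝ᵥ star (-z)))) * (Real.exp (-α * normSqSum (w + z)) : ℂ) := by
    rw [← exp_conj, ofReal_exp, ofReal_exp, ← Complex.exp_add, ← Complex.exp_add]
    push_cast
    rw [ofReal_normSqSum_add, star_neg, dotProduct_neg, add_dotProduct, dotProduct_star_self,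
      map_mul, map_neg, map_neg, map_add, conj_ofReal, conj_ofReal]
    ring_nf
  simp only [weylTranslate, add_neg_cancel_right, map_mul]
  linear_combination F (w + z) * conj (G w) * hexp

theorem isPolyanalytic_normSqSum_pow (i : ℕ) :
    IsPolyanalytic (i + 1) (fun w : Fin n → ℂ => (normSqSum w : ℂ) ^ i) := by
  induction i with
  | zero => exact .one_of_contDiff (by simpa using contDiff_const)
  | succ i ih =>
    have hsum : (fun w : Fin n → ℂ => (normSqSum w : ℂ) ^ (i + 1)) =
        ∑ r, (fun w : Fin n → ℂ => w r) * fun w => conj (w r) * (normSqSum w : ℂ) ^ i := by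
      ext w
      simp only [pow_succ', ← dotProduct_star_self, dotProduct, Pi.star_apply, RCLike.star_def,
        Finset.sum_apply, Pi.mul_apply, Finset.sum_mul, mul_assoc]
    rw [hsum]
    refine .sum _ fun r _ => .contDiff_mul (by fun_prop) ?_
    simpa using ih.conj_mul (ContinuousLinearMap.proj r) 0

/-- The radial function `w ↦ L_M^{(n)}(α |w|²)`, which reproduces the value at the origin. -/
def radialLaguerre (M : ℕ) (α : ℝ) (w : Fin n → ℂ) : ℂ :=
  ((laguerre n M).eval (α * normSqSum w) : ℝ)

theorem radialLaguerre_mem_fockSpace (hα : 0 < α) :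
    radialLaguerre M α ∈ fockSpace n (M + 1) α := by
  constructor
  · have hsum : radialLaguerre M α = ∑ i ∈ Finset.range (M + 1), fun w : Fin n → ℂ =>
        (((-1) ^ i * ((M + n).choose (n + i) : ℝ) / (i.factorial : ℝ) * α ^ i : ℝ) : ℂ) *
          (normSqSum w : ℂ) ^ i := by
      ext w
      simp only [radialLaguerre, eval_laguerre, Finset.sum_apply, mul_pow, ofReal_sum, ofReal_mul,
        ofReal_pow, mul_assoc]
    rw [hsum]
    exact .sum _ fun i hi => ((isPolyanalytic_normSqSum_pow i).mono
      (Nat.succ_le_succ (Finset.mem_range_succ_iff.1 hi))).const_mul _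
  · refine (integrable_eval_mul_exp_neg_mul_normSqSum
      (((laguerre n M).comp (Polynomial.C α * Polynomial.X)) ^ 2) hα).congr (.of_forall fun w => ?_)
    simp only [radialLaguerre, norm_real, Real.norm_eq_abs, sq_abs]
    rw [Polynomial.eval_pow, Polynomial.eval_comp, Polynomial.eval_C_mul, Polynomial.eval_X,
      normSqSum]

theorem fockInner_radialLaguerre (hn : 1 ≤ n) (hα : 0 < α) (hF : F ∈ fockSpace n (M + 1) α) :
    fockInner α F (radialLaguerre M α) = F 0 := by
  have hint := integral_mul_laguerre hn hα hF
  simp only [fockInner, radialLaguerre, conj_ofReal, mul_assoc, ← ofReal_mul]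
  rw [hint, ← mul_assoc, ← ofReal_mul, ← mul_pow, div_mul_div_cancel₀ Real.pi_ne_zero,
    div_self hα.ne', one_pow, ofReal_one, one_mul]

/-- The reproducing kernel of the Fock space of `(M + 1)`-analytic functions, the value at `z`
being the value at the origin of a Weyl translate. -/
def fockKernel (M : ℕ) (α : ℝ) (z : Fin n → ℂ) : (Fin n → ℂ) → ℂ :=
  weylTranslate α (-z) (radialLaguerre M α)

theorem fockKernel_apply (z w : Fin n → ℂ) :
    fockKernel M α z w =
      cexp (α * (w ⬝ᵥ star z)) * ((laguerre n M).eval (α * normSqSum (w - z)) : ℝ) := by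
  rw [fockKernel, weylTranslate, star_neg, dotProduct_neg, neg_mul_neg, radialLaguerre,
    ← sub_eq_add_neg]

theorem isReproducingKernel_fockKernel (hn : 1 ≤ n) (hα : 0 < α) :
    IsReproducingKernel (fockSpace n (M + 1) α) (fockInner α) (fockKernel M α) := by
  refine fun z => ⟨weylTranslate_mem_fockSpace _ (radialLaguerre_mem_fockSpace hα),
    fun F hF => ?_⟩
  rw [fockKernel, ← fockInner_weylTranslate_left,
    fockInner_radialLaguerre hn hα (weylTranslate_mem_fockSpace z hF), weylTranslate,
    zero_dotProduct, mul_zero, Complex.exp_zero, one_mul, zero_add]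

end FockKernel

section Flattening

variable {n M : ℕ} {α : ℝ}

theorem conj_flatInner (f g : (Fin n → ℝ) × (Fin n → ℝ) → ℂ) :
    conj (flatInner f g) = flatInner g f := by
  rw [flatInner, flatInner, map_mul, conj_ofReal, ← integral_conj]
  simp only [map_mul, conj_conj, mul_comm]

/-- The map `(x, y) ↦ (x + i y) / √α` along which `flatten` pulls functions back. -/
def toComplex (α : ℝ) (p : (Fin n → ℝ) × (Fin n → ℝ)) : Fin n → ℂ := fun r =>
  ((p.1 r : ℂ) + I * (p.2 r : ℂ)) / ((√α : ℝ) : ℂ)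

/-- The weight `2^{n/2} exp (-|x|²/2 - |y|²/2 - i⟨x,y⟩)` by which `flatten` multiplies. -/
def flatWeight (p : (Fin n → ℝ) × (Fin n → ℝ)) : ℂ :=
  (((2 : ℝ) ^ ((n : ℝ) / 2) : ℝ) : ℂ) *
    cexp (-(1 / 2 : ℂ) * ∑ r, (p.1 r : ℂ) ^ 2 - (1 / 2 : ℂ) * ∑ r, (p.2 r : ℂ) ^ 2
      - I * ∑ r, (p.1 r : ℂ) * (p.2 r : ℂ))

theorem toComplex_sub (p s : (Fin n → ℝ) × (Fin n → ℝ)) :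
    toComplex α (p - s) = toComplex α p - toComplex α s := by
  ext r
  simp only [toComplex, Pi.sub_apply, Prod.fst_sub, Prod.snd_sub, ofReal_sub]
  ring

theorem mul_toComplex_dotProduct_star (hα : 0 < α) (p s : (Fin n → ℝ) × (Fin n → ℝ)) :
    (α : ℂ) * (toComplex α p ⬝ᵥ star (toComplex α s)) =
      ∑ r, ((p.1 r : ℂ) + I * p.2 r) * ((s.1 r : ℂ) - I * s.2 r) := by
  have hsq : ((√α : ℝ) : ℂ) * ((√α : ℝ) : ℂ) = α := by
    rw [← ofReal_mul, Real.mul_self_sqrt hα.le]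
  have hα' : (α : ℂ) ≠ 0 := ofReal_ne_zero.2 hα.ne'
  rw [dotProduct, Finset.mul_sum]
  refine Finset.sum_congr rfl fun r _ => ?_
  simp only [toComplex, Pi.star_apply, RCLike.star_def, map_div₀, map_add, map_mul, conj_ofReal,
    conj_I]
  rw [div_mul_div_comm, hsq, mul_div_cancel₀ _ hα', neg_mul, ← sub_eq_add_neg]

theorem mul_normSqSum_toComplex (hα : 0 < α) (p : (Fin n → ℝ) × (Fin n → ℝ)) :
    α * normSqSum (toComplex α p) = ∑ r, (p.1 r ^ 2 + p.2 r ^ 2) := by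
  have h := mul_toComplex_dotProduct_star hα p p
  rw [dotProduct_star_self] at h
  refine ofReal_injective ?_
  push_cast
  rw [h]
  refine Finset.sum_congr rfl fun r _ => ?_
  linear_combination -(p.2 r : ℂ) ^ 2 * I_sq

theorem two_rpow_half_mul_self (n : ℕ) :
    (2 : ℝ) ^ ((n : ℝ) / 2) * (2 : ℝ) ^ ((n : ℝ) / 2) = 2 ^ n := by
  rw [← Real.rpow_add two_pos, add_halves, Real.rpow_natCast]

theorem flatWeight_mul_conj (hα : 0 < α) (p : (Fin n → ℝ) × (Fin n → ℝ)) :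
    flatWeight p * conj (flatWeight p) =
      ((2 ^ n * Real.exp (-α * normSqSum (toComplex α p)) : ℝ) : ℂ) := by
  rw [flatWeight, map_mul, conj_ofReal, mul_mul_mul_comm, ← ofReal_mul, two_rpow_half_mul_self,
    ← exp_conj, ← Complex.exp_add, neg_mul α, mul_normSqSum_toComplex hα, ofReal_mul, ofReal_exp]
  congr 2
  simp only [map_sub, map_mul, map_neg, map_sum, map_pow, conj_ofReal, conj_I, map_div₀, map_one,
    conj_ofNat, Finset.sum_add_distrib]
  push_cast
  ring

theorem integral_ofReal_add_I_mul (f : (Fin n → ℂ) → ℂ) :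
    ∫ p : (Fin n → ℝ) × (Fin n → ℝ), f (fun r => (p.1 r : ℂ) + I * p.2 r) = ∫ w, f w := by
  have hcurry := (volume_measurePreserving_arrowProdEquivProdArrow ℝ ℝ (Fin n)).symm
  have hcoord := volume_preserving_pi fun _ : Fin n =>
    Complex.volume_preserving_equiv_real_prod.symm
  rw [← hcoord.integral_comp (MeasurableEquiv.piCongrRight fun _ : Fin n =>
      Complex.measurableEquivRealProd.symm).measurableEmbedding,
    ← hcurry.integral_comp (MeasurableEquiv.measurableEmbedding _)]
  congr 2 with p
  congr 1 with r
  rw [Complex.measurableEquivRealProd_symm_apply]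
  simp [Complex.ext_iff, MeasurableEquiv.arrowProdEquivProdArrow, Equiv.arrowProdEquivProdArrow]

theorem integral_comp_toComplex (hα : 0 < α) (f : (Fin n → ℂ) → ℂ) :
    ∫ p, f (toComplex α p) = ((α ^ n : ℝ) : ℂ) * ∫ w, f w := by
  have hscale (p : (Fin n → ℝ) × (Fin n → ℝ)) :
      toComplex α p = (√α)⁻¹ • fun r => (p.1 r : ℂ) + I * p.2 r := by
    ext r
    rw [toComplex, Pi.smul_apply, real_smul, ofReal_inv, div_eq_inv_mul]
  have hdim : Module.finrank ℝ (Fin n → ℂ) = 2 * n := by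
    simp [Module.finrank_pi_fintype, finrank_real_complex, mul_comm]
  simp only [hscale]
  rw [integral_ofReal_add_I_mul fun w => f ((√α)⁻¹ • w), Measure.integral_comp_inv_smul, hdim,
    pow_mul, Real.sq_sqrt hα.le, abs_of_pos (pow_pos hα n), real_smul]

theorem flatInner_flatWeight_mul (hα : 0 < α) (F G : (Fin n → ℂ) → ℂ) :
    flatInner (fun p => flatWeight p * F (toComplex α p))
      (fun p => flatWeight p * G (toComplex α p)) = fockInner α F G := by
  have hpt (p : (Fin n → ℝ) × (Fin n → ℝ)) :
      flatWeight p * F (toComplex α p) * conj (flatWeight p * G (toComplex α p)) =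
        ((2 ^ n : ℝ) : ℂ) * (F (toComplex α p) * conj (G (toComplex α p)) *
          (Real.exp (-α * normSqSum (toComplex α p)) : ℂ)) := by
    rw [map_mul, mul_mul_mul_comm, flatWeight_mul_conj hα, ofReal_mul]
    ring
  simp only [flatInner, hpt]
  rw [integral_const_mul,
    integral_comp_toComplex hα fun w => F w * conj (G w) * (Real.exp (-α * normSqSum w) : ℂ),
    fockInner, ← mul_assoc, ← mul_assoc, ← ofReal_mul, ← ofReal_mul, mul_pow, div_pow]
  congr 2
  field_simp

/-- The reproducing kernel of the flattened space of `(M + 1)`-analytic functions. -/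
def flatKernel (M : ℕ) (α : ℝ) (p s : (Fin n → ℝ) × (Fin n → ℝ)) : ℂ :=
  flatWeight s * (conj (flatWeight p) * fockKernel M α (toComplex α p) (toComplex α s))

theorem isReproducingKernel_flatKernel (hn : 1 ≤ n) (hα : 0 < α) :
    IsReproducingKernel (flatSpace n (M + 1) α) flatInner (flatKernel M α) :=
  (isReproducingKernel_fockKernel hn hα).weighted_comp (fun a _ => const_mul_mem_fockSpace a)
    fockInner_const_mul_right (flatInner_flatWeight_mul hα)

end Flattening

section HorizontalFourier

variable {n M : ℕ} {α : ℝ}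

/-- The contribution of one coordinate to the integrand of the horizontal Fourier transform; the
first factor normalizes the Gaussian wave at frequency `ξ + v + y`. -/
def horizontalFactor (j : ℕ) (ξ y v u : ℝ) : ℂ :=
  (Real.exp (-(1 / 2) * (v - y) ^ 2) : ℂ) *
    (gaussWave (ξ + v + y) u * (((laguerre 0 j).eval (u ^ 2 + (v - y) ^ 2) : ℝ) : ℂ))

theorem integrable_horizontalFactor (j : ℕ) (ξ y v : ℝ) :
    Integrable (horizontalFactor j ξ y v) :=
  (integrable_gaussWave_mul_laguerre _ _ _ _).const_mul _

theorem integral_horizontalFactor (j : ℕ) (ξ y v : ℝ) :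
    ∫ u, horizontalFactor j ξ y v u = ((√(2 * Real.pi) * (√Real.pi *
      hermiteFun j ((ξ + 2 * y) / √2) * hermiteFun j ((ξ + 2 * v) / √2)) : ℝ) : ℂ) := by
  have hexp : Real.exp (-(1 / 2) * (v - y) ^ 2) * Real.exp (-(1 / 2) * (ξ + v + y) ^ 2) =
      Real.exp (-(1 / 4) * ((ξ + 2 * y) ^ 2 + (ξ + 2 * v) ^ 2)) := by
    rw [← Real.exp_add]
    ring_nf
  simp only [horizontalFactor]
  rw [integral_const_mul, integral_gaussWave_mul_laguerre, ← ofReal_mul,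
    sqrt_pi_mul_hermiteFun_mul_hermiteFun, ← hexp,
    show ξ + v + y - (v - y) = ξ + 2 * y by ring, show ξ + v + y + (v - y) = ξ + 2 * v by ring]
  ring_nf

theorem flatWeight_mul_exp_eq_prod (hα : 0 < α) (ξ y v u : Fin n → ℝ) :
    flatWeight (u, v) * conj (flatWeight (0, y)) *
        cexp (α * (toComplex α (u, v) ⬝ᵥ star (toComplex α (0, y)))) *
        cexp (-I * ∑ r, (u r : ℂ) * (ξ r : ℂ)) =
      2 ^ n * ∏ r, (Real.exp (-(1 / 2) * (v r - y r) ^ 2) : ℂ) *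
        gaussWave (ξ r + v r + y r) (u r) := by
  rw [flatWeight, flatWeight, map_mul, conj_ofReal, mul_mul_mul_comm, ← ofReal_mul,
    two_rpow_half_mul_self, mul_toComplex_dotProduct_star hα, ← exp_conj]
  simp only [gaussWave, ofReal_exp, mul_assoc, ← Complex.exp_add, ← Complex.exp_sum]
  push_cast
  congr 2
  simp only [map_sub, map_mul, map_neg, map_sum, map_pow, conj_ofReal, conj_I, map_div₀, map_one,
    conj_ofNat, Finset.mul_sum, ← Finset.sum_add_distrib, ← Finset.sum_sub_distrib,
    Pi.zero_apply, ofReal_zero, map_zero]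
  refine Finset.sum_congr rfl fun r _ => ?_
  linear_combination -(v r : ℂ) * (y r : ℂ) * I_sq

theorem horizontalIntegrand_flatKernel (hα : 0 < α) (ξ y v u : Fin n → ℝ) :
    horizontalIntegrand (flatKernel M α) ξ y v u = ∑ k ∈ multiIndices n (M + 1),
      2 ^ n * ∏ r, horizontalFactor (k r) (ξ r) (y r) (v r) (u r) := by
  have hlag : (((laguerre n M).eval
      (α * normSqSum (toComplex α (u, v) - toComplex α (0, y))) : ℝ) : ℂ) =
      ∑ k ∈ multiIndices n (M + 1),
        ∏ r, (((laguerre 0 (k r)).eval (u r ^ 2 + (v r - y r) ^ 2) : ℝ) : ℂ) := by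
    rw [← toComplex_sub, mul_normSqSum_toComplex hα, Prod.mk_sub_mk, sub_zero,
      ← sum_multiIndices_prod_laguerre]
    push_cast
    rfl
  have hprod (k : Fin n → ℕ) :
      2 ^ n * ∏ r, horizontalFactor (k r) (ξ r) (y r) (v r) (u r) =
        flatWeight (u, v) * conj (flatWeight (0, y)) *
          cexp (α * (toComplex α (u, v) ⬝ᵥ star (toComplex α (0, y)))) *
          cexp (-I * ∑ r, (u r : ℂ) * (ξ r : ℂ)) *
          ∏ r, (((laguerre 0 (k r)).eval (u r ^ 2 + (v r - y r) ^ 2) : ℝ) : ℂ) := by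
    rw [flatWeight_mul_exp_eq_prod hα, mul_assoc, ← Finset.prod_mul_distrib]
    simp only [horizontalFactor, mul_assoc]
  rw [horizontalIntegrand, flatKernel, fockKernel_apply, hlag,
    Finset.sum_congr rfl fun k _ => hprod k, ← Finset.mul_sum]
  ring

theorem integrable_prod_horizontalFactor (k : Fin n → ℕ) (ξ y v : Fin n → ℝ) :
    Integrable fun u : Fin n → ℝ =>
      (2 : ℂ) ^ n * ∏ r, horizontalFactor (k r) (ξ r) (y r) (v r) (u r) :=
  (Integrable.fintype_prod (f := fun r => horizontalFactor (k r) (ξ r) (y r) (v r))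
    fun _ => integrable_horizontalFactor _ _ _ _).const_mul _

theorem two_pi_rpow_mul_sqrt_two_pi_pow (n : ℕ) :
    (2 * Real.pi) ^ (-(n : ℝ) / 2) * √(2 * Real.pi) ^ n = 1 := by
  have hpos : 0 < 2 * Real.pi := Real.two_pi_pos
  rw [Real.sqrt_eq_rpow, ← Real.rpow_mul_natCast hpos.le, ← Real.rpow_add hpos,
    show -(n : ℝ) / 2 + 1 / 2 * n = 0 by ring, Real.rpow_zero]

theorem pi_rpow_quarter_mul_self (n : ℕ) :
    Real.pi ^ ((n : ℝ) / 4) * Real.pi ^ ((n : ℝ) / 4) = √Real.pi ^ n := by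
  rw [Real.sqrt_eq_rpow, ← Real.rpow_mul_natCast Real.pi_pos.le, ← Real.rpow_add Real.pi_pos]
  ring_nf

theorem integral_prod_horizontalFactor (k : Fin n → ℕ) (ξ y v : Fin n → ℝ) :
    (((2 * Real.pi) ^ (-(n : ℝ) / 2) : ℝ) : ℂ) *
      ∫ u : Fin n → ℝ, 2 ^ n * ∏ r, horizontalFactor (k r) (ξ r) (y r) (v r) (u r) =
        q k ξ y * q k ξ v := by
  rw [integral_const_mul, integral_fintype_prod_volume_eq_prod
    (f := fun r => horizontalFactor (k r) (ξ r) (y r) (v r)), ← ofReal_ofNat, ← ofReal_pow]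
  simp only [integral_horizontalFactor, q, ← ofReal_prod, ← ofReal_mul, Finset.prod_mul_distrib,
    Finset.prod_const, Finset.card_univ, Fintype.card_fin]
  rw [← two_rpow_half_mul_self, ← pi_rpow_quarter_mul_self]
  congr 1
  linear_combination ((2 : ℝ) ^ ((n : ℝ) / 2) * (2 : ℝ) ^ ((n : ℝ) / 2) *
    (Real.pi ^ ((n : ℝ) / 4) * Real.pi ^ ((n : ℝ) / 4)) *
    (∏ r, hermiteFun (k r) ((ξ r + 2 * y r) / √2)) *
    ∏ r, hermiteFun (k r) ((ξ r + 2 * v r) / √2)) * two_pi_rpow_mul_sqrt_two_pi_pow n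

theorem integrable_horizontalIntegrand_flatKernel (hα : 0 < α) (ξ y v : Fin n → ℝ) :
    Integrable (horizontalIntegrand (flatKernel M α) ξ y v) := by
  rw [funext (horizontalIntegrand_flatKernel hα ξ y v)]
  exact integrable_finsetSum _ fun k _ => integrable_prod_horizontalFactor k ξ y v

theorem horizontalFourier_flatKernel (hα : 0 < α) (ξ y v : Fin n → ℝ) :
    horizontalFourier (flatKernel M α) ξ y v =
      ∑ k ∈ multiIndices n (M + 1), q k ξ y * q k ξ v := by
  rw [horizontalFourier, funext (horizontalIntegrand_flatKernel hα ξ y v),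
    integral_finsetSum _ fun k _ => integrable_prod_horizontalFactor k ξ y v, Finset.mul_sum]
  exact Finset.sum_congr rfl fun k _ => integral_prod_horizontalFactor k ξ y v

theorem conj_q (k : Fin n → ℕ) (ξ v : Fin n → ℝ) : conj (q k ξ v) = q k ξ v :=
  conj_ofReal _

end HorizontalFourier

end PolyFock

end

theorem mainTheorem2 (n m : ℕ) (hn : 1 ≤ n) (hm : 1 ≤ m) (α : ℝ) (hα : 0 < α) :
    (∃! K : (Fin n → ℝ) × (Fin n → ℝ) → (Fin n → ℝ) × (Fin n → ℝ) → ℂ,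
      PolyFock.IsReproducingKernel (PolyFock.flatSpace n m α) PolyFock.flatInner K) ∧
    (∀ K : (Fin n → ℝ) × (Fin n → ℝ) → (Fin n → ℝ) × (Fin n → ℝ) → ℂ,
      PolyFock.IsReproducingKernel (PolyFock.flatSpace n m α) PolyFock.flatInner K →
      ∀ ξ y v : Fin n → ℝ,
        Integrable (PolyFock.horizontalIntegrand K ξ y v) volume ∧
        PolyFock.horizontalFourier K ξ y v =
          ∑ k ∈ PolyFock.multiIndices n m, conj (PolyFock.q k ξ y) * PolyFock.q k ξ v ∧
        PolyFock.horizontalFourier K ξ y v =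
          ∑ k ∈ PolyFock.multiIndices n m, PolyFock.q k ξ y * PolyFock.q k ξ v) ∧
    (PolyFock.multiIndices n m).card = (n + m - 1).choose n := by
  obtain ⟨M, rfl⟩ := Nat.exists_eq_add_of_le' hm
  have hK := PolyFock.isReproducingKernel_flatKernel (M := M) hn hα
  refine ⟨⟨_, hK, fun K hK' => hK'.unique PolyFock.conj_flatInner hK⟩, ?_,
    PolyFock.card_multiIndices n M⟩
  intro K hK' ξ y v
  rw [hK'.unique PolyFock.conj_flatInner hK]
  simp only [PolyFock.conj_q]
  have hL := PolyFock.horizontalFourier_flatKernel (M := M) hα ξ y v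
  exact ⟨PolyFock.integrable_horizontalIntegrand_flatKernel hα ξ y v, hL, hL⟩
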